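/- **Theorem 4.5.** Let $d\in\{1,2,\dots\}\cup\{\infty\}$ and let $(X_n)_{n\le 0}$ be a Markov process (not necessarily homogeneous or stationary) with values in $\mathbb{R}^d$ (with $\mathbb R^\infty=\mathbb R^{\mathbb N}$ carrying the product topology), with transition kernels $P_{n+1}(x,\cdot)=\mathcal{L}(X_{n+1}\mid X_n=x)$, $n<0$. Let $\mathcal{F}=(\mathcal{F}_n)_{n\le 0}$, $\mathcal F_n=\sigma(X_m;\,m\le n)$, be the filtration it generates, let $\mathcal{F}_{-\infty}=\bigcap_{n\le 0}\mathcal{F}_n$, and let $A_n$ be the support of the law of $X_n$. Assume that $(X_n)$ is *monotonic*: for every $n<0$ and all $x,x'\in A_n$ there is a coupling $(Y,Y')$ of $P_{n+1}(x,\cdot)$ and $P_{n+1}(x',\cdot)$, whose law depends measurably on $(x,x')$, which is *well-ordered* with respect to $(x,x')$, that is, for every coordinate $k$: if $x(k)\le x'(k)$ then $Y(k)\le Y'(k)$ almost surely, and if $x(k)\ge x'(k)$ then $Y(k)\ge Y'(k)$ almost surely. Then the following conditions are equivalent. (a) $\mathcal{F}$ is Kolmogorovian, i.e. every event of $\mathcal{F}_{-\infty}$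 has probability $0$ or $1$. (b) For every $n\le 0$, the conditional law $\mathcal{L}(X_n\mid\mathcal{F}_{-\infty})$ is almost surely equal to $\mathcal{L}(X_n)$. (c) $\mathcal{F}$ is standard, i.e., up to isomorphism, it is immersed in a filtration of product type. Here a filtration is of *product type* if it is generated by a sequence of independent random variables $(U_n)_{n\le0}$ (each with values in a standard Borel space); a filtration $\mathcal{F}'$ is *immersed* in a filtration $\mathcal{G}$ on the same probability space if $\mathcal{F}'_n\subset\mathcal{G}_n$ for all $n\le0$ and, for every $n<0$, $\mathcal{F}'_{n+1}$ and $\mathcal{G}_n$ are conditionally independent given $\mathcal{F}'_n$; and two filtrations, possibly on different probability spaces, are *isomorphic* if they are generated by two processes $(Y_n)_{n\le0}$, $(Y'_n)_{n\le0}$ (with values in standard Borel spaces) having the same law. -/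

import Mathlib

open MeasureTheory ProbabilityTheory

/-!
Time runs over the non-positive integers and is indexed by `ℕ` through `n ↦ -n`: `X n` is the
value of the process at time `-n`, and `F n` is the sigma-field at time `-n`. Thus the past of
time `-n` consists of the indices `m ≥ n`, and one step forward in time goes from `n + 1` to `n`.
-/

namespace NegTime

/-- The filtration generated by a process `Y`: at time `-n` it is the sigma-field generated by
the variables `Y m`, `m ≥ n`. -/
@[reducible] def generated {Ω : Type*} {S : ℕ → Type*} [∀ n, MeasurableSpace (S n)]
    (Y : (n : ℕ) → Ω → S n) (n : ℕ) : MeasurableSpace Ω :=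
  ⨆ (m : ℕ) (_ : n ≤ m), MeasurableSpace.comap (Y m) inferInstance

/-- The tail sigma-field `F_{-∞}`, the intersection of all `F n`. -/
@[reducible] def tail {Ω : Type*} (F : ℕ → MeasurableSpace Ω) : MeasurableSpace Ω := ⨅ n, F n

/-- A filtration is Kolmogorovian when its tail sigma-field is degenerate. -/
def IsKolmogorovian {Ω : Type*} [MeasurableSpace Ω] (μ : Measure Ω)
    (F : ℕ → MeasurableSpace Ω) : Prop :=
  ∀ s : Set Ω, MeasurableSet[tail F] s → μ s = 0 ∨ μ s = 1

/-- The (regular) conditional law `ℒ(Y | m)` of the random variable `Y` given a sub-sigma-field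
`m`, as a kernel from `(Ω, m)` to the state space. -/
noncomputable def condLaw {Ω S : Type*} [mΩ : MeasurableSpace Ω] [mS : MeasurableSpace S]
    [StandardBorelSpace S] [Nonempty S] (μ : Measure Ω) [IsFiniteMeasure μ]
    (m : MeasurableSpace Ω) (Y : Ω → S) : @Kernel Ω S m mS :=
  @condDistrib Ω Ω S mS _ _ mΩ m Y id μ _

/-- The filtration `F` is immersed in the filtration `G`: `F n ⊆ G n` for all `n`, and, at each
step, the next sigma-field of `F` is conditionally independent of the present sigma-field of `G`
given the present sigma-field of `F`. -/
def IsImmersed {Ω : Type*} [MeasurableSpace Ω] (μ : Measure Ω)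
    (F G : ℕ → MeasurableSpace Ω) : Prop :=
  (∀ n, F n ≤ G n) ∧
  ∀ n : ℕ, ∀ s t : Set Ω, MeasurableSet[F n] s → MeasurableSet[G (n + 1)] t →
    μ⟦s ∩ t | F (n + 1)⟧ =ᵐ[μ] μ⟦s | F (n + 1)⟧ * μ⟦t | F (n + 1)⟧

/-- A filtration is of product type when it is generated by a sequence of independent
random variables. -/
def IsProductType {Ω : Type*} [MeasurableSpace Ω] (μ : Measure Ω)
    (G : ℕ → MeasurableSpace Ω) : Prop :=
  ∃ (S : ℕ → Type) (_ : ∀ n, MeasurableSpace (S n)) (_ : ∀ n, StandardBorelSpace (S n))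
    (U : (n : ℕ) → Ω → S n),
    (∀ n, Measurable (U n)) ∧ iIndepFun U μ ∧ ∀ n, G n = generated U n

/-- Two filtrations, on possibly different probability spaces, are isomorphic when they are
generated by two copies of the same process, i.e. by two processes with the same law. -/
def IsIsomorphic {Ω Ω' : Type*} [MeasurableSpace Ω] [MeasurableSpace Ω']
    (μ : Measure Ω) (F : ℕ → MeasurableSpace Ω)
    (μ' : Measure Ω') (F' : ℕ → MeasurableSpace Ω') : Prop :=
  ∃ (S : ℕ → Type) (_ : ∀ n, MeasurableSpace (S n)) (_ : ∀ n, StandardBorelSpace (S n))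
    (Y : (n : ℕ) → Ω → S n) (Y' : (n : ℕ) → Ω' → S n),
    (∀ n, Measurable (Y n)) ∧ (∀ n, Measurable (Y' n)) ∧
    (∀ n, F n = generated Y n) ∧ (∀ n, F' n = generated Y' n) ∧
    μ.map (fun ω n => Y n ω) = μ'.map (fun ω n => Y' n ω)

/-- A filtration is standard when it is, up to isomorphism, immersed in a filtration of
product type. -/
def IsStandard {Ω : Type*} [MeasurableSpace Ω] (μ : Measure Ω)
    (F : ℕ → MeasurableSpace Ω) : Prop :=
  ∃ (Ω' : Type) (_ : MeasurableSpace Ω') (μ' : Measure Ω') (_ : IsProbabilityMeasure μ')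
    (F' G : ℕ → MeasurableSpace Ω'),
    IsIsomorphic μ F μ' F' ∧ IsProductType μ' G ∧ IsImmersed μ' F' G

/-- `X` is a Markov process (with respect to the filtration it generates, not necessarily
homogeneous) with transition kernels `P`: the conditional law of the value at time `-n` given the
past up to time `-(n + 1)` is `P n` evaluated at the value at time `-(n + 1)`. -/
def IsMarkovProcess {Ω E : Type*} [MeasurableSpace Ω] [MeasurableSpace E]
    [StandardBorelSpace E] [Nonempty E] (μ : Measure Ω) [IsFiniteMeasure μ]
    (X : ℕ → Ω → E) (P : ℕ → Kernel E E) : Prop :=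
  ∀ n : ℕ, ∀ᵐ ω ∂μ, condLaw μ (generated X (n + 1)) (X n) ω = P n (X (n + 1) ω)

/-- A law `ν` of a pair `(Y, Y')` is well-ordered with respect to `(x, x')`. -/
def IsWellOrdered {ι : Type*} (x x' : ι → ℝ) (ν : Measure ((ι → ℝ) × (ι → ℝ))) : Prop :=
  ∀ k : ι, (x k ≤ x' k → ∀ᵐ y ∂ν, y.1 k ≤ y.2 k) ∧ (x' k ≤ x k → ∀ᵐ y ∂ν, y.2 k ≤ y.1 k)

/-- The process `X` with transition kernels `P` is monotonic: at each step there is a coupling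
`Λ (x, x')` of `P n x` and `P n x'`, depending measurably on `(x, x')`, which is well-ordered with
respect to `(x, x')` for all `x, x'` in the support of the law of the present value `X (n + 1)`
(the values of `Λ` at other pairs are irrelevant). -/
def IsMonotonic {Ω ι : Type*} [MeasurableSpace Ω] (μ : Measure Ω)
    (X : ℕ → Ω → (ι → ℝ)) (P : ℕ → Kernel (ι → ℝ) (ι → ℝ)) : Prop :=
  ∀ n : ℕ, ∃ Λ : Kernel ((ι → ℝ) × (ι → ℝ)) ((ι → ℝ) × (ι → ℝ)), IsMarkovKernel Λ ∧
    ∀ x ∈ (μ.map (X (n + 1))).support, ∀ x' ∈ (μ.map (X (n + 1))).support,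
      (Λ (x, x')).map Prod.fst = P n x ∧ (Λ (x, x')).map Prod.snd = P n x' ∧
      IsWellOrdered x x' (Λ (x, x'))

end NegTime

/-!
The implications from Kolmogorovian to constant conditional laws, and from standard to
Kolmogorovian, hold for every process: a trivial tail is independent of everything, and the
filtration of a standard process is, up to isomorphism, contained in one to which Kolmogorov's
zero-one law applies (`IsStandard.isKolmogorovian`).

The content is that a monotonic chain `X`, with `ℒ(X n | F_{-∞}) = ℒ(X n)` for all `n`, is standard
(`isStandard_generated`). Copies of the chain are built on a space of independent uniform variables
indexed by time and by a level `j` (`ladder`). Level `j` starts at time `-T j` from a fresh draw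
with the right law and moves with the kernels `P`. Once level `j` has started, level `j + 1` is
coupled with it: given the step made by level `j`, its own step is drawn, with its own noise, from
the conditional kernel of the well-ordered coupling. Thus two consecutive levels keep, in each
coordinate, the order they have at time `-T j`. So the mean distance at time `-n` between
the images under the sigmoid function of their `k`-th coordinates is a difference of two means, and
is at most twice the mean distance between `E[sigmoid (X n k) | X (T j)]` and its mean
(`IsLadder.lintegral_edist_le`). By Lévy's downward theorem
(`tendsto_lintegral_condExp_sub_const`) and the hypothesis on the tail, this tends to zero as
`T j → ∞`; for `T` growing fast enough the levels converge almost surely.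

All levels have the same marginal laws as `X`. This has two consequences: the sigmoid images
cannot converge to `0` or `1`, so the levels themselves converge (`ae_exists_tendsto_of_sigmoid`),
and `h (Y j) → h Y` in `L¹` for every bounded measurable `h` when the levels `Y j` converge to `Y`,
so that the limit moves with the kernels `P` although these are not assumed to be continuous
(`hasCondLaw_of_ae_tendsto`). The limit is adapted to the filtration of the noise and is a Markov
chain relative to it; hence it has the law of `X` (`map_eq_of_hasCondLaw`) and its filtration is
immersed in that of the noise (`isImmersed_of_hasCondLaw`).
-/

namespace NegTime

open Filter
open scoped ENNReal Topology unitInterval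

/-! ### Conditional laws -/

section CondLaw

variable {Ω S : Type*} {m m' : MeasurableSpace Ω} [mΩ : MeasurableSpace Ω] [mS : MeasurableSpace S]
  {μ : Measure Ω}

/-- The random measure `K` is a conditional law of `Y` given `m`, tested against non-negative
functions of `Y` and of an `m`-measurable parameter. The `m`-measurability of `K` is not part of
the definition: in all uses `K` is a kernel applied to an `m`-measurable variable. -/
def HasCondLaw (μ : Measure Ω) (m : MeasurableSpace Ω) (Y : Ω → S) (K : Ω → Measure S) : Prop :=
  ∀ θ : Ω × S → ℝ≥0∞, Measurable[m.prod mS] θ →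
    ∫⁻ ω, θ (ω, Y ω) ∂μ = ∫⁻ ω, ∫⁻ y, θ (ω, y) ∂(K ω) ∂μ

lemma HasCondLaw.lintegral_comp {β : Type*} [MeasurableSpace β] {Y : Ω → S} {K : Ω → Measure S}
    (h : HasCondLaw μ m Y K) {A : Ω → β} (hA : Measurable[m] A) {θ : β × S → ℝ≥0∞}
    (hθ : Measurable θ) :
    ∫⁻ ω, θ (A ω, Y ω) ∂μ = ∫⁻ ω, ∫⁻ y, θ (A ω, y) ∂(K ω) ∂μ := by
  refine h (fun p => θ (A p.1, p.2)) ?_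
  have h1 : Measurable[m.prod mS] (fun p : Ω × S => (A p.1, p.2)) :=
    (hA.comp (@measurable_fst _ _ m mS)).prodMk (@measurable_snd _ _ m mS)
  exact hθ.comp h1

lemma HasCondLaw.lintegral_mul {Y : Ω → S} {K : Ω → Measure S}
    (h : HasCondLaw μ m Y K) {Z : Ω → ℝ≥0∞} (hZ : Measurable[m] Z) {ψ : S → ℝ≥0∞}
    (hψ : Measurable ψ) :
    ∫⁻ ω, Z ω * ψ (Y ω) ∂μ = ∫⁻ ω, Z ω * ∫⁻ y, ψ y ∂(K ω) ∂μ := by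
  have := h.lintegral_comp (θ := fun p : ℝ≥0∞ × S => p.1 * ψ p.2) hZ (by fun_prop)
  simpa [lintegral_const_mul _ hψ] using this

lemma HasCondLaw.lintegral {Y : Ω → S} {K : Ω → Measure S}
    (h : HasCondLaw μ m Y K) {ψ : S → ℝ≥0∞} (hψ : Measurable ψ) :
    ∫⁻ ω, ψ (Y ω) ∂μ = ∫⁻ ω, ∫⁻ y, ψ y ∂(K ω) ∂μ := by
  simpa using h.lintegral_mul (Z := 1) (@measurable_const _ _ _ m _) hψ

lemma HasCondLaw.setLIntegral (hm : m ≤ mΩ) {Y : Ω → S} {K : Ω → Measure S}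
    (h : HasCondLaw μ m Y K) {t : Set Ω} (ht : MeasurableSet[m] t) {ψ : S → ℝ≥0∞}
    (hψ : Measurable ψ) :
    ∫⁻ ω in t, ψ (Y ω) ∂μ = ∫⁻ ω in t, ∫⁻ y, ψ y ∂(K ω) ∂μ := by
  have hZ : Measurable[m] (t.indicator fun _ => (1 : ℝ≥0∞)) :=
    (@measurable_const _ _ _ m _).indicator ht
  have := h.lintegral_mul hZ hψ
  rw [← lintegral_indicator (hm _ ht), ← lintegral_indicator (hm _ ht)]
  refine Eq.trans ?_ (this.trans ?_) <;>
  · refine lintegral_congr fun ω => ?_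
    by_cases hω : ω ∈ t <;> simp [hω]

lemma HasCondLaw.congr {Y : Ω → S} {K K' : Ω → Measure S} (h : HasCondLaw μ m Y K)
    (hK : ∀ᵐ ω ∂μ, K ω = K' ω) : HasCondLaw μ m Y K' := by
  intro θ hθ
  rw [h θ hθ]
  refine lintegral_congr_ae ?_
  filter_upwards [hK] with ω hω
  rw [hω]

/-- A disintegration of the joint law of `(p, Y)`, tested against functions. -/
lemma lintegral_eq_of_map_prodMk_eq {Ω₀ : Type*} [MeasurableSpace Ω₀] [IsFiniteMeasure μ]
    {p : Ω → Ω₀} (hp : Measurable p) {Y : Ω → S} (hY : Measurable Y) {κ : Kernel Ω₀ S}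
    [IsSFiniteKernel κ] (h : μ.map (fun ω => (p ω, Y ω)) = μ.map p ⊗ₘ κ)
    {θ : Ω₀ × S → ℝ≥0∞} (hθ : Measurable θ) :
    ∫⁻ ω, θ (p ω, Y ω) ∂μ = ∫⁻ ω, ∫⁻ y, θ (p ω, y) ∂(κ (p ω)) ∂μ := by
  rw [← lintegral_map (f := θ) (g := fun ω => (p ω, Y ω)) hθ (by fun_prop), h,
    Measure.lintegral_compProd hθ,
    lintegral_map (Measurable.lintegral_kernel_prod_right' hθ) hp]

lemma hasCondLaw_condLaw [StandardBorelSpace S] [Nonempty S] [IsFiniteMeasure μ] (hm : m ≤ mΩ)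
    {Y : Ω → S} (hY : Measurable Y) : HasCondLaw μ m Y (condLaw μ m Y) := by
  intro θ hθ
  have h := @compProd_map_condDistrib Ω Ω S _ _ _ mΩ μ _ id Y m hY.aemeasurable
  exact @lintegral_eq_of_map_prodMk_eq Ω S mΩ _ μ Ω m _ id (measurable_id'' hm) Y hY _
    (by infer_instance) h.symm θ hθ

/-- A kernel applied to an `m`-measurable variable is a conditional law as soon as it gives the
right mass to rectangles. -/
lemma hasCondLaw_of_setLIntegral {β : Type*} [MeasurableSpace β] [IsFiniteMeasure μ] (hm : m ≤ mΩ)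
    {Y : Ω → S} (hY : Measurable Y) (κ : Kernel β S) [IsMarkovKernel κ] {A : Ω → β}
    (hA : Measurable[m] A)
    (h : ∀ t, MeasurableSet[m] t → ∀ B, MeasurableSet B →
      μ (t ∩ Y ⁻¹' B) = ∫⁻ ω in t, κ (A ω) B ∂μ) :
    HasCondLaw μ m Y (fun ω => κ (A ω)) := by
  intro θ hθ
  have key : ∀ {Ω₀ : Type _} [MeasurableSpace Ω₀] {p : Ω → Ω₀} (hp : Measurable p)
      {κ' : Kernel Ω₀ S} [IsMarkovKernel κ']
      (hr : ∀ t, MeasurableSet t → ∀ B, MeasurableSet B →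
        μ (p ⁻¹' t ∩ Y ⁻¹' B) = ∫⁻ ω in p ⁻¹' t, κ' (p ω) B ∂μ),
      μ.map (fun ω => (p ω, Y ω)) = μ.map p ⊗ₘ κ' := by
    intro Ω₀ _ p hp κ' _ hr
    refine Measure.ext_prod fun {t B} ht hB => ?_
    rw [Measure.map_apply (by fun_prop) (ht.prod hB), Measure.compProd_apply_prod ht hB,
      setLIntegral_map ht (κ'.measurable_coe hB) hp]
    exact hr t ht B hB
  exact @lintegral_eq_of_map_prodMk_eq Ω S mΩ _ μ Ω m _ id (measurable_id'' hm) Y hY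
    (@Kernel.comap _ _ _ _ _ m κ A hA) (by infer_instance)
    (@key Ω m id (measurable_id'' hm) (@Kernel.comap _ _ _ _ _ m κ A hA) (by infer_instance) h) θ hθ

lemma hasCondLaw_of_indep [IsProbabilityMeasure μ] (hm : m ≤ mΩ) {Y : Ω → S} (hY : Measurable Y)
    (h : Indep m (mS.comap Y) μ) : HasCondLaw μ m Y (fun _ => μ.map Y) := by
  have := Measure.isProbabilityMeasure_map (μ := μ) hY.aemeasurable
  refine hasCondLaw_of_setLIntegral hm hY (Kernel.const Unit (μ.map Y)) (A := fun _ => ())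
    (@measurable_const _ _ _ m _) fun t ht B hB => ?_
  rw [(Indep_iff _ _ _).1 h t _ ht ⟨B, hB, rfl⟩]
  simp [Measure.map_apply hY hB, mul_comm]

/-- Conditional laws compose along an increasing pair of sigma-fields. -/
lemma HasCondLaw.comp {T α : Type*} [MeasurableSpace T] [MeasurableSpace α] {Y : Ω → S}
    {Y' : Ω → T} {A : Ω → α} {κ : Kernel α S} {η : Kernel S T} [IsSFiniteKernel η]
    (h : HasCondLaw μ m Y (fun ω => κ (A ω))) (h' : HasCondLaw μ m' Y' (fun ω => η (Y ω)))
    (hmm : m ≤ m') : HasCondLaw μ m Y' (fun ω => (η ∘ₖ κ) (A ω)) := by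
  intro θ hθ
  have hle : m.prod (inferInstance : MeasurableSpace T) ≤ m'.prod inferInstance :=
    sup_le_sup (MeasurableSpace.comap_mono hmm) le_rfl
  have key : ∀ {Ω₀ : Type _} [MeasurableSpace Ω₀] {θ : Ω₀ × T → ℝ≥0∞}, Measurable θ →
      Measurable (fun p : Ω₀ × S => ∫⁻ y, θ (p.1, y) ∂(η p.2)) := by
    intro Ω₀ _ θ hθ
    have : Measurable (fun q : (Ω₀ × S) × T => θ (q.1.1, q.2)) := by fun_prop
    exact Measurable.lintegral_kernel_prod_right' (κ := η.comap Prod.snd measurable_snd) this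
  rw [h' θ (hθ.mono hle le_rfl), h (fun p => ∫⁻ y, θ (p.1, y) ∂(η p.2)) (@key Ω m θ hθ)]
  refine lintegral_congr fun ω => ?_
  rw [Kernel.lintegral_comp]
  exact hθ.comp (@measurable_prodMk_left _ _ m _ ω)

/-- Sampling with a fresh variable `V` turns the noise law into the law prescribed by `κ`. -/
lemma HasCondLaw.sample {T α : Type*} [MeasurableSpace T] [MeasurableSpace α] {V : Ω → S}
    {ρ : Measure S} [SFinite ρ] {A : Ω → α} {κ : Kernel α T} {c : α → S → T}
    (h : HasCondLaw μ m V (fun _ => ρ)) (hA : Measurable[m] A)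
    (hc : Measurable (Function.uncurry c)) (hcκ : ∀ a, ρ.map (c a) = κ a) :
    HasCondLaw μ m (fun ω => c (A ω) (V ω)) (fun ω => κ (A ω)) := by
  intro θ hθ
  have key : ∀ {Ω₀ : Type _} [MeasurableSpace Ω₀] {θ : Ω₀ × T → ℝ≥0∞} {A : Ω₀ → α},
      Measurable A → Measurable θ → Measurable (fun p : Ω₀ × S => θ (p.1, c (A p.1) p.2)) := by
    intro Ω₀ _ θ A hA hθ
    have : Measurable fun p : Ω₀ × S => c (A p.1) p.2 :=
      hc.comp ((hA.comp measurable_fst).prodMk measurable_snd)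
    fun_prop
  rw [h (fun p => θ (p.1, c (A p.1) p.2)) (@key Ω m θ A hA hθ)]
  refine lintegral_congr fun ω => ?_
  change _ = ∫⁻ y, θ (ω, y) ∂(κ (A ω))
  rw [← hcκ, lintegral_map]
  · exact hθ.comp (@measurable_prodMk_left _ _ m _ ω)
  · exact hc.of_uncurry_left

end CondLaw

/-! ### Almost sure limits of identically distributed variables -/

section Limits

variable {Ω : Type*} [MeasurableSpace Ω] {μ : Measure Ω}

lemma ae_exists_tendsto_of_lintegral_edist_le {Y : ℕ → Ω → ℝ} (hY : ∀ i, Measurable (Y i))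
    (h : ∀ᶠ i in atTop, ∫⁻ ω, edist (Y i ω) (Y (i + 1) ω) ∂μ ≤ ENNReal.ofReal ((1 / 2) ^ i)) :
    ∀ᵐ ω ∂μ, ∃ l, Tendsto (fun i => Y i ω) atTop (𝓝 l) := by
  obtain ⟨N, hN⟩ := eventually_atTop.1 h
  have hmeas : ∀ i, Measurable fun ω => edist (Y (i + N) ω) (Y (i + 1 + N) ω) :=
    fun i => (hY _).edist (hY _)
  have hfin : ∫⁻ ω, ∑' i, edist (Y (i + N) ω) (Y (i + 1 + N) ω) ∂μ ≠ ∞ := by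
    rw [lintegral_tsum fun i => (hmeas i).aemeasurable]
    have hsum : Summable fun i : ℕ => ((1 : ℝ) / 2) ^ (i + N) :=
      (summable_nat_add_iff N).2 summable_geometric_two
    refine ne_top_of_le_ne_top hsum.tsum_ofReal_ne_top (ENNReal.tsum_le_tsum fun i => ?_)
    have := hN (i + N) (by omega)
    rwa [show i + N + 1 = i + 1 + N by omega] at this
  filter_upwards [ae_lt_top (Measurable.tsum hmeas) hfin] with ω hω
  have hc : CauchySeq fun i => Y (i + N) ω :=
    cauchySeq_of_edist_le_of_tsum_ne_top _ (fun i => le_rfl) hω.ne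
  obtain ⟨l, hl⟩ := cauchySeq_tendsto_of_complete hc
  exact ⟨l, (tendsto_add_atTop_iff_nat N).1 hl⟩

lemma ofReal_integral_abs_sub {f g : Ω → ℝ} (hf : Integrable f μ) (hg : Integrable g μ) :
    ENNReal.ofReal (∫ ω, |f ω - g ω| ∂μ) = ∫⁻ ω, ‖f ω - g ω‖ₑ ∂μ := by
  have h : Integrable (fun ω => |f ω - g ω|) μ := (hf.sub hg).abs
  rw [ofReal_integral_eq_lintegral_ofReal h (ae_of_all _ fun ω => abs_nonneg _)]
  simp only [Real.enorm_eq_ofReal_abs]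

variable {E : Type*} [TopologicalSpace E] [TopologicalSpace.PseudoMetrizableSpace E]
  [MeasurableSpace E] [BorelSpace E]

lemma map_eq_of_ae_tendsto [IsFiniteMeasure μ] {ν : Measure E} {Y : ℕ → Ω → E} {Z : Ω → E}
    (hY : ∀ i, Measurable (Y i)) (hZ : AEMeasurable Z μ) (hlaw : ∀ᶠ i in atTop, μ.map (Y i) = ν)
    (h : ∀ᵐ ω ∂μ, Tendsto (fun i => Y i ω) atTop (𝓝 (Z ω))) : μ.map Z = ν := by
  have : IsFiniteMeasure ν := by
    obtain ⟨i, hi⟩ := hlaw.exists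
    rw [← hi]; infer_instance
  refine ext_of_forall_integral_eq_of_IsFiniteMeasure fun f => ?_
  have h1 : Tendsto (fun i => ∫ ω, f (Y i ω) ∂μ) atTop (𝓝 (∫ ω, f (Z ω) ∂μ)) := by
    refine tendsto_integral_of_dominated_convergence (fun _ => ‖f‖)
      (fun i => (f.continuous.measurable.comp (hY i)).aestronglyMeasurable)
      (integrable_const _) (fun i => ae_of_all _ fun ω => f.norm_coe_le_norm _) ?_
    filter_upwards [h] with ω hω
    exact (f.continuous.tendsto _).comp hω
  have h2 : Tendsto (fun i => ∫ ω, f (Y i ω) ∂μ) atTop (𝓝 (∫ x, f x ∂ν)) := by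
    refine tendsto_const_nhds.congr' ?_
    filter_upwards [hlaw] with i hi
    rw [← hi, integral_map (hY i).aemeasurable f.continuous.measurable.aestronglyMeasurable]
  rw [integral_map hZ f.continuous.measurable.aestronglyMeasurable]
  exact tendsto_nhds_unique h1 h2

/-- Composition with a merely integrable function preserves convergence, in `L¹`, of variables
sharing the same law: the function is approximated by a continuous one in `L¹` of that law. -/
lemma tendsto_lintegral_enorm_sub_comp [IsFiniteMeasure μ] {ν : Measure E} {Y : ℕ → Ω → E}
    {Z : Ω → E} (hY : ∀ i, Measurable (Y i)) (hZ : Measurable Z)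
    (hlaw : ∀ᶠ i in atTop, μ.map (Y i) = ν)
    (h : ∀ᵐ ω ∂μ, Tendsto (fun i => Y i ω) atTop (𝓝 (Z ω)))
    {f : E → ℝ} (hf : Measurable f) (hfi : Integrable f ν) :
    Tendsto (fun i => ∫⁻ ω, ‖f (Y i ω) - f (Z ω)‖ₑ ∂μ) atTop (𝓝 0) := by
  have hZν := map_eq_of_ae_tendsto hY hZ.aemeasurable hlaw h
  have : IsFiniteMeasure ν := by rw [← hZν]; infer_instance
  let _ := TopologicalSpace.pseudoMetrizableSpacePseudoMetric E
  rw [ENNReal.tendsto_nhds_zero]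
  intro ε hε
  obtain ⟨δ, hδ, hδε⟩ : ∃ δ : ℝ≥0∞, δ ≠ 0 ∧ δ + δ + δ ≤ ε :=
    ⟨ε / 3, (ENNReal.div_pos hε.ne' (by simp)).ne', (ENNReal.add_thirds ε).le⟩
  obtain ⟨g, hg, -⟩ := hfi.exists_boundedContinuous_lintegral_sub_le hδ
  have hgm := g.continuous.measurable
  have h1 : Tendsto (fun i => ∫⁻ ω, ‖g (Y i ω) - g (Z ω)‖ₑ ∂μ) atTop (𝓝 0) := by
    have h0 : Tendsto (fun i => ∫⁻ ω, ‖g (Y i ω) - g (Z ω)‖ₑ ∂μ) atTop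
        (𝓝 (∫⁻ _, 0 ∂μ)) := by
      refine tendsto_lintegral_of_dominated_convergence' (fun _ => ‖g‖ₑ + ‖g‖ₑ)
        (fun i => by fun_prop) (fun i => ae_of_all _ fun ω => ?_) ?_ ?_
      · refine (enorm_sub_le (a := g (Y i ω)) (b := g (Z ω))).trans (add_le_add ?_ ?_) <;>
        exact enorm_le_iff_norm_le.2 (g.norm_coe_le_norm _)
      · simp [ENNReal.mul_eq_top, enorm_ne_top]
      · filter_upwards [h] with ω hω
        have := ((g.continuous.tendsto _).comp hω).sub_const (g (Z ω))
        simpa using this.enorm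
    simpa using h0
  filter_upwards [hlaw, ENNReal.tendsto_nhds_zero.1 h1 δ (pos_iff_ne_zero.2 hδ)] with i hi hi1
  have hYi : ∫⁻ ω, ‖f (Y i ω) - g (Y i ω)‖ₑ ∂μ ≤ δ := by
    rw [← hi, lintegral_map (by fun_prop) (hY i)] at hg
    exact hg
  have hZi : ∫⁻ ω, ‖g (Z ω) - f (Z ω)‖ₑ ∂μ ≤ δ := by
    rw [← hZν, lintegral_map (by fun_prop) hZ] at hg
    simpa only [enorm_sub_rev] using hg
  calc ∫⁻ ω, ‖f (Y i ω) - f (Z ω)‖ₑ ∂μ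
      ≤ ∫⁻ ω, (‖f (Y i ω) - g (Y i ω)‖ₑ + ‖g (Y i ω) - g (Z ω)‖ₑ) + ‖g (Z ω) - f (Z ω)‖ₑ ∂μ := by
        refine lintegral_mono fun ω => ?_
        have : f (Y i ω) - f (Z ω) =
          (f (Y i ω) - g (Y i ω)) + (g (Y i ω) - g (Z ω)) + (g (Z ω) - f (Z ω)) := by ring
        simp only [this]
        exact (enorm_add_le _ _).trans (add_le_add (enorm_add_le _ _) le_rfl)
    _ = ∫⁻ ω, ‖f (Y i ω) - g (Y i ω)‖ₑ ∂μ + ∫⁻ ω, ‖g (Y i ω) - g (Z ω)‖ₑ ∂μ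
        + ∫⁻ ω, ‖g (Z ω) - f (Z ω)‖ₑ ∂μ := by
        rw [lintegral_add_left (by fun_prop), lintegral_add_left (by fun_prop)]
    _ ≤ δ + δ + δ := by gcongr
    _ ≤ ε := hδε

/-- For real variables with a common law, convergence of the images under the sigmoid function
forces convergence: the limit has the law of the images, hence does not charge `{0, 1}`. -/
lemma ae_exists_tendsto_of_sigmoid [IsFiniteMeasure μ] {ρ : Measure ℝ} {Y : ℕ → Ω → ℝ}
    (hY : ∀ i, Measurable (Y i)) (hlaw : ∀ᶠ i in atTop, μ.map (Y i) = ρ)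
    (h : ∀ᵐ ω ∂μ, ∃ l, Tendsto (fun i => (Y i ω).sigmoid) atTop (𝓝 l)) :
    ∀ᵐ ω ∂μ, ∃ l, Tendsto (fun i => Y i ω) atTop (𝓝 l) := by
  have hs : Measurable Real.sigmoid := continuous_sigmoid.measurable
  obtain ⟨Z, hZ, hlim⟩ := measurable_limit_of_tendsto_metrizable_ae
    (fun i => (hs.comp (hY i)).aemeasurable) h
  have hZlaw : μ.map Z = ρ.map Real.sigmoid := by
    refine map_eq_of_ae_tendsto (fun i => hs.comp (hY i)) hZ.aemeasurable ?_ hlim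
    filter_upwards [hlaw] with i hi
    rw [← hi, Measure.map_map hs (hY i)]
  have hemb : Topology.IsEmbedding Real.sigmoid :=
    Real.sigmoid_strictMono.isEmbedding_of_ordConnected
      (by rw [Real.range_sigmoid]; exact Set.ordConnected_Ioo)
  have hrange : ∀ᵐ ω ∂μ, Z ω ∈ Set.range Real.sigmoid := by
    have hms : MeasurableSet (Set.range Real.sigmoid) := by
      rw [Real.range_sigmoid]; exact measurableSet_Ioo
    refine ae_of_ae_map hZ.aemeasurable (p := fun x => x ∈ Set.range Real.sigmoid) ?_
    rw [hZlaw]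
    exact (ae_map_iff hs.aemeasurable hms).2 (ae_of_all _ fun x => ⟨x, rfl⟩)
  filter_upwards [hlim, hrange] with ω hω hx
  obtain ⟨x, hx⟩ := hx
  refine ⟨x, hemb.tendsto_nhds_iff.2 ?_⟩
  rwa [hx]

end Limits

/-! ### Downward convergence of conditional expectations -/

section Downward

variable {Ω : Type*} [mΩ : MeasurableSpace Ω] {μ : Measure Ω} [IsProbabilityMeasure μ]

lemma sq_integral_abs_le {g : Ω → ℝ} (hg : MemLp g 2 μ) :
    (∫ ω, |g ω| ∂μ) ^ 2 ≤ ∫ ω, g ω ^ 2 ∂μ := by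
  have h := variance_nonneg (fun ω => |g ω|) μ
  rw [variance_eq_sub (X := fun ω => |g ω|) hg.norm] at h
  simpa using h

/-- Lévy's downward theorem in `L¹`, when the variable `Y` with values in `[0, 1]` has a constant
conditional expectation `c` given the intersection of the sigma-fields. Along a subsequence the
conditional expectations converge almost surely, because their second moments decrease; the limit
is measurable for the intersection, hence equal to `c`. -/
lemma tendsto_lintegral_condExp_sub_const {F : ℕ → MeasurableSpace Ω} (hF : Antitone F)
    (hle : ∀ n, F n ≤ mΩ) {Y : Ω → ℝ} (hY : Measurable Y) (hY0 : ∀ ω, 0 ≤ Y ω)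
    (hY1 : ∀ ω, Y ω ≤ 1) {c : ℝ}
    (hc : ∀ t, MeasurableSet[⨅ n, F n] t → ∫ ω in t, Y ω ∂μ = c * μ.real t) :
    Tendsto (fun n => ∫⁻ ω, ‖(μ[Y | F n]) ω - c‖ₑ ∂μ) atTop (𝓝 0) := by
  have hYi : Integrable Y μ := Integrable.of_bound hY.aestronglyMeasurable 1
    (ae_of_all _ fun ω => by rw [Real.norm_eq_abs, abs_of_nonneg (hY0 ω)]; exact hY1 ω)
  set v : ℕ → Ω → ℝ := fun n => μ[Y | F n] with hvdef
  have hvF : ∀ n, StronglyMeasurable[F n] (v n) := fun n => stronglyMeasurable_condExp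
  have hvm : ∀ n, Measurable (v n) := fun n => ((hvF n).mono (hle n)).measurable
  have hv01 : ∀ n, ∀ᵐ ω ∂μ, 0 ≤ v n ω ∧ v n ω ≤ 1 := by
    intro n
    have h0 : (0 : Ω → ℝ) ≤ᵐ[μ] v n := condExp_nonneg (ae_of_all _ hY0)
    have h1 : v n ≤ᵐ[μ] μ[(fun _ => (1 : ℝ)) | F n] :=
      condExp_mono hYi (integrable_const _) (ae_of_all _ hY1)
    rw [condExp_const (hle n)] at h1
    filter_upwards [h0, h1] with ω h0 h1 using ⟨h0, h1⟩
  have hvb : ∀ n, ∀ᵐ ω ∂μ, ‖v n ω‖ ≤ 1 := fun n => by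
    filter_upwards [hv01 n] with ω hω
    rw [Real.norm_eq_abs, abs_of_nonneg hω.1]; exact hω.2
  have hvL : ∀ n, MemLp (v n) 2 μ := fun n =>
    MemLp.of_bound (hvm n).aestronglyMeasurable 1 (hvb n)
  have hvi : ∀ n, Integrable (v n) μ := fun n => (hvL n).integrable one_le_two
  have horth : ∀ N M, N ≤ M → ∫ ω, v N ω * v M ω ∂μ = ∫ ω, v M ω ^ 2 ∂μ := by
    intro N M hNM
    have hmul : Integrable (v N * v M) μ := (hvL N).integrable_mul (hvL M)
    have h1 : μ[v N * v M | F M] =ᵐ[μ] μ[v N | F M] * v M :=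
      condExp_mul_of_stronglyMeasurable_right (hvF M) hmul (hvi N)
    have h2 : μ[v N | F M] =ᵐ[μ] v M := condExp_condExp_of_le (hF hNM) (hle N)
    calc ∫ ω, v N ω * v M ω ∂μ = ∫ ω, (μ[v N * v M | F M]) ω ∂μ := (integral_condExp (hle M)).symm
      _ = ∫ ω, v M ω ^ 2 ∂μ := by
        refine integral_congr_ae ?_
        filter_upwards [h1, h2] with ω h1 h2
        rw [h1, Pi.mul_apply, h2, sq]
  set a : ℕ → ℝ := fun n => ∫ ω, v n ω ^ 2 ∂μ with hadef
  have hdiff : ∀ N M, N ≤ M → ∫ ω, (v N ω - v M ω) ^ 2 ∂μ = a N - a M := by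
    intro N M hNM
    have hmul : Integrable (fun ω => v N ω * v M ω) μ := (hvL N).integrable_mul (hvL M)
    have : ∀ ω, (v N ω - v M ω) ^ 2 = v N ω ^ 2 - 2 * (v N ω * v M ω) + v M ω ^ 2 :=
      fun ω => by ring
    simp_rw [this]
    have hsub : Integrable (fun ω => v N ω ^ 2 - 2 * (v N ω * v M ω)) μ :=
      (hvL N).integrable_sq.sub (hmul.const_mul 2)
    rw [integral_add hsub (hvL M).integrable_sq,
      integral_sub (hvL N).integrable_sq (hmul.const_mul 2), integral_const_mul, horth N M hNM]
    simp only [hadef]; ring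
  have hanti : Antitone a := fun N M hNM => by
    have := hdiff N M hNM
    have h0 : 0 ≤ ∫ ω, (v N ω - v M ω) ^ 2 ∂μ := integral_nonneg fun ω => sq_nonneg _
    linarith
  have hbdd : BddBelow (Set.range a) :=
    ⟨0, by rintro _ ⟨n, rfl⟩; exact integral_nonneg fun ω => sq_nonneg _⟩
  have hlim := tendsto_atTop_ciInf hanti hbdd
  set ℓ := ⨅ n, a n
  have hℓ : ∀ n, ℓ ≤ a n := fun n => ciInf_le hbdd n
  obtain ⟨φ, hφ, hφa⟩ := extraction_forall_of_eventually (P := fun i n => a n < ℓ + (1 / 4) ^ i)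
    fun i => hlim.eventually (gt_mem_nhds (by have : (0 : ℝ) < (1 / 4) ^ i := by positivity
                                              linarith))
  have habs : ∀ i, ∫ ω, |v (φ i) ω - v (φ (i + 1)) ω| ∂μ ≤ (1 / 2) ^ i := by
    intro i
    have h1 := sq_integral_abs_le ((hvL (φ i)).sub (hvL (φ (i + 1))))
    simp only [Pi.sub_apply] at h1
    rw [hdiff _ _ (hφ.monotone (Nat.le_succ i))] at h1
    refine abs_le_of_sq_le_sq' (h1.trans ?_) (by positivity) |>.2
    rw [← pow_mul, mul_comm i 2, pow_mul]
    have := hφa i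
    have := hℓ (φ (i + 1))
    norm_num at *
    linarith
  -- the upper limit is taken instead of the limit to get a function measurable for the tail
  have hconv := ae_exists_tendsto_of_lintegral_edist_le (μ := μ) (fun i => hvm (φ i)) <|
    Eventually.of_forall fun i => by
      refine le_trans (le_of_eq ?_) (ENNReal.ofReal_le_ofReal (habs i))
      rw [ofReal_integral_abs_sub (hvi _) (hvi _)]
      simp only [edist_eq_enorm_sub]
  set Z : Ω → ℝ := fun ω => limsup (fun i => v (φ i) ω) atTop with hZdef
  have hZlim : ∀ᵐ ω ∂μ, Tendsto (fun i => v (φ i) ω) atTop (𝓝 (Z ω)) := by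
    filter_upwards [hconv] with ω hω
    obtain ⟨l, hl⟩ := hω
    simp only [hZdef]
    rwa [hl.limsup_eq]
  have hZtail : Measurable[⨅ n, F n] Z := by
    refine measurable_iff_comap_le.2 (le_iInf fun n => measurable_iff_comap_le.1 ?_)
    have : Z = fun ω => limsup (fun i => v (φ (i + n)) ω) atTop := by
      funext ω
      exact (limsup_nat_add (fun i => v (φ i) ω) n).symm
    rw [this]
    refine Measurable.limsup fun i => ?_
    exact (hvF (φ (i + n))).measurable.mono (hF ((Nat.le_add_left n i).trans (hφ.id_le _))) le_rfl
  have htl : (⨅ n, F n) ≤ mΩ := (iInf_le _ 0).trans (hle 0)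
  have hZb : ∀ᵐ ω ∂μ, ‖Z ω‖ ≤ 1 := by
    filter_upwards [hZlim, ae_all_iff.2 hvb] with ω hω hb
    exact le_of_tendsto hω.norm (Eventually.of_forall fun i => hb (φ i))
  have hZi : Integrable Z μ :=
    Integrable.of_bound (hZtail.mono htl le_rfl).aestronglyMeasurable 1 hZb
  have hZc : Z =ᵐ[μ] fun _ => c := by
    refine ae_eq_of_forall_setIntegral_eq_of_sigmaFinite' htl (fun _ _ _ => hZi.integrableOn)
      (fun _ _ _ => (integrable_const c).integrableOn) (fun t ht _ => ?_)
      hZtail.aestronglyMeasurable aestronglyMeasurable_const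
    have h1 : Tendsto (fun i => ∫ ω in t, v (φ i) ω ∂μ) atTop (𝓝 (∫ ω in t, Z ω ∂μ)) :=
      tendsto_integral_of_dominated_convergence (fun _ => 1)
        (fun i => (hvm _).aestronglyMeasurable) (integrable_const _)
        (fun i => ae_restrict_of_ae (hvb _)) (ae_restrict_of_ae hZlim)
    have h2 : ∀ i, ∫ ω in t, v (φ i) ω ∂μ = c * μ.real t := fun i => by
      rw [← hc t ht]
      exact setIntegral_condExp (hle _) hYi (iInf_le F _ _ ht)
    simp_rw [h2] at h1
    rw [tendsto_nhds_unique h1 tendsto_const_nhds]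
    simp [mul_comm]
  have hℓc : ℓ = c ^ 2 := by
    have h1 : Tendsto (fun i => a (φ i)) atTop (𝓝 (∫ ω, Z ω ^ 2 ∂μ)) := by
      refine tendsto_integral_of_dominated_convergence (fun _ => 1)
        (fun i => ((hvm _).pow_const 2).aestronglyMeasurable) (integrable_const _)
        (fun i => ?_) ?_
      · filter_upwards [hvb (φ i)] with ω hω
        rw [norm_pow]
        exact pow_le_one₀ (norm_nonneg _) hω
      · filter_upwards [hZlim] with ω hω using hω.pow 2
    rw [tendsto_nhds_unique (hlim.comp hφ.tendsto_atTop) h1]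
    rw [integral_congr_ae (g := fun _ => c ^ 2) (by filter_upwards [hZc] with ω hω; rw [hω])]
    simp
  have hmean : ∀ n, ∫ ω, v n ω ∂μ = c := fun n => by
    have := hc Set.univ MeasurableSet.univ
    simp only [Measure.restrict_univ, probReal_univ, mul_one] at this
    rw [← this]
    exact integral_condExp (hle n)
  have hsq : ∀ n, ∫ ω, (v n ω - c) ^ 2 ∂μ = a n - c ^ 2 := fun n => by
    have : ∀ ω, (v n ω - c) ^ 2 = v n ω ^ 2 - 2 * c * v n ω + c ^ 2 := fun ω => by ring
    simp_rw [this]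
    have hsub : Integrable (fun ω => v n ω ^ 2 - 2 * c * v n ω) μ :=
      (hvL n).integrable_sq.sub ((hvi n).const_mul _)
    rw [integral_add hsub (integrable_const _),
      integral_sub (hvL n).integrable_sq ((hvi n).const_mul _), integral_const_mul, hmean]
    simp [hadef]; ring
  have hbound : ∀ n, ∫ ω, |v n ω - c| ∂μ ≤ √(a n - c ^ 2) := fun n => by
    rw [← hsq n]
    exact Real.le_sqrt_of_sq_le (sq_integral_abs_le ((hvL n).sub (memLp_const c)))
  have hz : Tendsto (fun n => ENNReal.ofReal (√(a n - c ^ 2))) atTop (𝓝 0) := by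
    have : Tendsto (fun n => √(a n - c ^ 2)) atTop (𝓝 (√(ℓ - c ^ 2))) :=
      (hlim.sub_const _).sqrt
    rw [hℓc, sub_self, Real.sqrt_zero] at this
    simpa using ENNReal.tendsto_ofReal this
  refine tendsto_of_tendsto_of_tendsto_of_le_of_le tendsto_const_nhds hz (fun _ => zero_le)
    fun n => ?_
  refine le_trans (le_of_eq ?_) (ENNReal.ofReal_le_ofReal (hbound n))
  rw [ofReal_integral_abs_sub (hvi _) (integrable_const c)]

end Downward

/-! ### Conditional laws given by kernels -/

section CondLawKernel

variable {Ω S β : Type*} {m m' : MeasurableSpace Ω} [mΩ : MeasurableSpace Ω] [MeasurableSpace S]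
  [MeasurableSpace β] {μ : Measure Ω}

lemma HasCondLaw.ae_mem {Y : Ω → S} {K : Ω → Measure S} (h : HasCondLaw μ m Y K) (hm : m ≤ mΩ)
    (hY : Measurable Y) {A : Ω → β} (hA : Measurable[m] A) {B : Set (β × S)}
    (hB : MeasurableSet B) (hAB : ∀ᵐ ω ∂μ, ∀ᵐ y ∂(K ω), (A ω, y) ∈ B) :
    ∀ᵐ ω ∂μ, (A ω, Y ω) ∈ B := by
  have h1 := h.lintegral_comp (θ := Bᶜ.indicator fun _ => 1) hA
    (measurable_const.indicator hB.compl)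
  have hA' : Measurable A := hA.mono hm le_rfl
  have h2 : ∫⁻ ω, ∫⁻ y, Bᶜ.indicator (fun _ => 1) (A ω, y) ∂(K ω) ∂μ = 0 := by
    refine (lintegral_congr_ae ?_).trans lintegral_zero
    filter_upwards [hAB] with ω hω
    refine (lintegral_congr_ae ?_).trans lintegral_zero
    filter_upwards [hω] with y hy
    simp [hy]
  rw [h2, lintegral_eq_zero_iff] at h1
  · filter_upwards [h1] with ω hω
    by_contra hn
    simp [hn] at hω
  · exact (measurable_const.indicator hB.compl).comp (hA'.prodMk hY)

lemma HasCondLaw.map_eq {Y : Ω → S} {κ : Kernel β S} {A : Ω → β}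
    (h : HasCondLaw μ m Y (fun ω => κ (A ω))) (hY : Measurable Y) (hA : Measurable A) :
    μ.map Y = κ ∘ₘ μ.map A := by
  ext B hB
  have := h.lintegral (ψ := B.indicator 1) (measurable_one.indicator hB)
  simp only [lintegral_indicator_one hB] at this
  rw [Measure.bind_apply hB κ.aemeasurable, lintegral_map (κ.measurable_coe hB) hA, ← this,
    ← lintegral_map (measurable_one.indicator hB) hY, lintegral_indicator_one hB]

/-- Refining a conditional law: if `Y` has conditional law `P (a ω)` given `m`, if `Y'` is then
drawn from the conditional kernel of `Λ`, and if `Λ` has first marginal `P` almost surely, then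
`(Y, Y')` has conditional law `Λ (a ω, b ω)` given `m`. -/
lemma HasCondLaw.prodMk_of_condKernel {T : Type*} [MeasurableSpace T] [StandardBorelSpace T]
    [Nonempty T] [MeasurableSpace.CountablyGenerated S] {Y : Ω → S} {Y' : Ω → T} {P : Kernel β S}
    {Λ : Kernel (β × β) (S × T)} [IsFiniteKernel Λ] {a b : Ω → β} (hmm : m ≤ m')
    (ha : Measurable[m] a) (hb : Measurable[m] b) (hY : Measurable[m'] Y)
    (h : HasCondLaw μ m Y (fun ω => P (a ω)))
    (h' : HasCondLaw μ m' Y' (fun ω => Λ.condKernel ((a ω, b ω), Y ω)))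
    (hΛ : ∀ᵐ ω ∂μ, (Λ (a ω, b ω)).map Prod.fst = P (a ω)) :
    HasCondLaw μ m (fun ω => (Y ω, Y' ω)) (fun ω => Λ (a ω, b ω)) := by
  intro θ hθ
  have key' : Measurable[m'.prod inferInstance] (fun p : Ω × T => θ (p.1, (Y p.1, p.2))) := by
    have aux : ∀ {Ω₀ : Type _} {n₁ : MeasurableSpace Ω₀} [n₀ : MeasurableSpace Ω₀]
        {θ : Ω₀ × (S × T) → ℝ≥0∞} {Y : Ω₀ → S}, n₁ ≤ n₀ → Measurable Y →
        Measurable[n₁.prod inferInstance] θ →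
        Measurable (fun p : Ω₀ × T => θ (p.1, (Y p.1, p.2))) := by
      intro Ω₀ n₁ n₀ θ Y hn hY hθ
      have hθ' : Measurable θ :=
        hθ.mono (sup_le_sup (MeasurableSpace.comap_mono hn) le_rfl) le_rfl
      fun_prop
    exact @aux Ω m m' θ Y hmm hY hθ
  have key : ∀ {Ω₀ : Type _} [MeasurableSpace Ω₀] {θ : Ω₀ × (S × T) → ℝ≥0∞} {a b : Ω₀ → β},
      Measurable a → Measurable b → Measurable θ →
      Measurable (fun p : Ω₀ × S =>
        ∫⁻ z, θ (p.1, (p.2, z)) ∂(Λ.condKernel ((a p.1, b p.1), p.2))) := by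
    intro Ω₀ _ θ a b ha hb hθ
    have hg : Measurable fun p : Ω₀ × S => ((a p.1, b p.1), p.2) := by fun_prop
    have : Measurable (fun q : (Ω₀ × S) × T => θ (q.1.1, (q.1.2, q.2))) := by fun_prop
    exact Measurable.lintegral_kernel_prod_right' (κ := Λ.condKernel.comap _ hg) this
  rw [h' _ key']
  rw [h (fun p => ∫⁻ z, θ (p.1, (p.2, z)) ∂(Λ.condKernel ((a p.1, b p.1), p.2)))
    (@key Ω m θ a b ha hb hθ)]
  refine lintegral_congr_ae ?_
  filter_upwards [hΛ] with ω hω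
  have hθω : Measurable fun z : S × T => θ (ω, z) := hθ.comp (@measurable_prodMk_left _ _ m _ ω)
  have h1 : ∫⁻ z, θ (ω, z) ∂(Λ (a ω, b ω))
      = ∫⁻ z, θ (ω, z) ∂((Λ.fst ⊗ₖ Λ.condKernel) (a ω, b ω)) := by
    rw [Kernel.disintegrate]
  rw [h1, Kernel.lintegral_compProd _ _ _ hθω, Kernel.fst_apply, hω]

lemma HasCondLaw.snd {T : Type*} [MeasurableSpace T] {Y : Ω → S} {Y' : Ω → T}
    {K : Ω → Measure (S × T)} (h : HasCondLaw μ m (fun ω => (Y ω, Y' ω)) K) :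
    HasCondLaw μ m Y' (fun ω => (K ω).map Prod.snd) := by
  intro θ hθ
  have aux : ∀ {Ω₀ : Type _} [MeasurableSpace Ω₀] {θ : Ω₀ × T → ℝ≥0∞}, Measurable θ →
      Measurable (fun p : Ω₀ × (S × T) => θ (p.1, p.2.2)) := fun hθ => by fun_prop
  rw [h (fun p => θ (p.1, p.2.2)) (@aux Ω m θ hθ)]
  refine lintegral_congr fun ω => ?_
  rw [lintegral_map _ measurable_snd]
  exact hθ.comp (@measurable_prodMk_left _ _ m _ ω)

lemma integrable_comp_of_mem_Icc [IsFiniteMeasure μ] {Y : Ω → S} {f : S → ℝ} (hf : Measurable f)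
    (hf0 : ∀ y, 0 ≤ f y) (hf1 : ∀ y, f y ≤ 1) (hY : Measurable Y) :
    Integrable (fun ω => f (Y ω)) μ :=
  Integrable.of_bound (hf.comp hY).aestronglyMeasurable 1
    (ae_of_all _ fun ω => by rw [Real.norm_eq_abs, abs_of_nonneg (hf0 _)]; exact hf1 _)

lemma integral_kernel_mem_Icc {κ : Kernel β S} [IsMarkovKernel κ] {f : S → ℝ}
    (hf : Measurable f) (hf0 : ∀ y, 0 ≤ f y) (hf1 : ∀ y, f y ≤ 1) (x : β) :
    0 ≤ ∫ y, f y ∂(κ x) ∧ ∫ y, f y ∂(κ x) ≤ 1 := by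
  refine ⟨integral_nonneg hf0, ?_⟩
  have := integral_mono (μ := κ x) (integrable_comp_of_mem_Icc hf hf0 hf1 measurable_id)
    (integrable_const 1) hf1
  simpa using this

lemma measurable_integral_kernel {κ : Kernel β S} [IsMarkovKernel κ] {f : S → ℝ}
    (hf : Measurable f) : Measurable fun x => ∫ y, f y ∂(κ x) :=
  (StronglyMeasurable.integral_kernel_prod_right' (κ := κ) (f := fun p => f p.2)
    (hf.comp measurable_snd).stronglyMeasurable).measurable

lemma HasCondLaw.setIntegral [IsFiniteMeasure μ] (hm : m ≤ mΩ) {Y : Ω → S} {κ : Kernel β S}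
    [IsMarkovKernel κ] {A : Ω → β} (h : HasCondLaw μ m Y (fun ω => κ (A ω)))
    (hY : Measurable Y) (hA : Measurable[m] A)
    {t : Set Ω} (ht : MeasurableSet[m] t) {f : S → ℝ}
    (hf : Measurable f) (hf0 : ∀ y, 0 ≤ f y) (hf1 : ∀ y, f y ≤ 1) :
    ∫ ω in t, f (Y ω) ∂μ = ∫ ω in t, ∫ y, f y ∂(κ (A ω)) ∂μ := by
  have hA' : Measurable A := hA.mono hm le_rfl
  rw [integral_eq_lintegral_of_nonneg_ae (ae_of_all _ fun ω => hf0 _)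
      (hf.comp hY).aestronglyMeasurable,
    integral_eq_lintegral_of_nonneg_ae (ae_of_all _ fun ω => integral_nonneg hf0)
      ((measurable_integral_kernel hf).comp hA').aestronglyMeasurable]
  congr 1
  refine (h.setLIntegral hm ht (ψ := fun y => ENNReal.ofReal (f y)) (by fun_prop)).trans ?_
  refine lintegral_congr fun ω => ?_
  have hi : Integrable f (κ (A ω)) := integrable_comp_of_mem_Icc hf hf0 hf1 measurable_id
  rw [ofReal_integral_eq_lintegral_ofReal hi (ae_of_all _ hf0)]

lemma HasCondLaw.condExp_eq [IsFiniteMeasure μ] (hm : m ≤ mΩ) {Y : Ω → S} {κ : Kernel β S}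
    [IsMarkovKernel κ] {A : Ω → β} (h : HasCondLaw μ m Y (fun ω => κ (A ω)))
    (hY : Measurable Y) (hA : Measurable[m] A) {f : S → ℝ}
    (hf : Measurable f) (hf0 : ∀ y, 0 ≤ f y) (hf1 : ∀ y, f y ≤ 1) :
    (fun ω => ∫ y, f y ∂(κ (A ω))) =ᵐ[μ] μ[fun ω => f (Y ω) | m] := by
  have hA' : Measurable A := hA.mono hm le_rfl
  have hg := measurable_integral_kernel (κ := κ) hf
  refine ae_eq_condExp_of_forall_setIntegral_eq hm (integrable_comp_of_mem_Icc hf hf0 hf1 hY)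
    (fun t _ _ => (integrable_comp_of_mem_Icc hg
      (fun x => (integral_kernel_mem_Icc hf hf0 hf1 x).1)
      (fun x => (integral_kernel_mem_Icc hf hf0 hf1 x).2) hA').integrableOn)
    (fun t ht _ => (h.setIntegral hm hY hA ht hf hf0 hf1).symm) ?_
  exact (hg.comp hA).aestronglyMeasurable

end CondLawKernel

/-! ### Transition kernels over several steps -/

section Transition

variable {E : Type*} [MeasurableSpace E]

/-- The transition kernel over `l` steps, from time `-(n + l)` to time `-n`. -/
noncomputable def transition (P : ℕ → Kernel E E) : ℕ → ℕ → Kernel E E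
  | _, 0 => Kernel.id
  | n, l + 1 => P n ∘ₖ transition P (n + 1) l

instance isMarkovKernel_transition (P : ℕ → Kernel E E) [hP : ∀ n, IsMarkovKernel (P n)]
    (n l : ℕ) : IsMarkovKernel (transition P n l) := by
  induction l generalizing n with
  | zero => unfold transition; infer_instance
  | succ l ih => unfold transition; have := ih (n + 1); infer_instance

lemma hasCondLaw_transition {Ω : Type*} [MeasurableSpace Ω] {μ : Measure Ω}
    {F : ℕ → MeasurableSpace Ω} (hF : Antitone F) {P : ℕ → Kernel E E}
    [∀ n, IsMarkovKernel (P n)] {Z : ℕ → Ω → E} {N : ℕ} (hZ : Measurable[F N] (Z N))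
    (h : ∀ n < N, HasCondLaw μ (F (n + 1)) (Z n) (fun ω => P n (Z (n + 1) ω))) :
    ∀ l n, n + l = N → HasCondLaw μ (F N) (Z n) (fun ω => transition P n l (Z N ω)) := by
  intro l
  induction l with
  | zero =>
    rintro n rfl θ hθ
    refine lintegral_congr fun ω => ?_
    simp only [transition, Kernel.id_apply]
    rw [lintegral_dirac']
    · rfl
    · exact hθ.comp (@measurable_prodMk_left _ _ (F n) _ ω)
  | succ l ih =>
    intro n hn
    exact (ih (n + 1) (by omega)).comp (h n (by omega)) (hF (by omega))

end Transition

/-! ### The noise -/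

section Noise

/-- The law of a doubly indexed family of independent uniform variables on `[0, 1]`. The first
index is time, the second one the level of the approximation that uses the variable. -/
noncomputable def noise : Measure (ℕ → ℕ → I) :=
  Measure.infinitePi fun _ => Measure.infinitePi fun _ => volume

instance : IsProbabilityMeasure noise := by unfold noise; infer_instance

/-- The filtration generated by the noise. -/
@[reducible] def noiseFiltration : ℕ → MeasurableSpace (ℕ → ℕ → I) :=
  generated (fun n (u : ℕ → ℕ → I) => u n)

/-- The noise strictly before time `-n`, together with the noise of the levels below `j` at
time `-n`. -/
@[reducible] def noiseBelow (n j : ℕ) : MeasurableSpace (ℕ → ℕ → I) :=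
  noiseFiltration (n + 1) ⊔
    ⨆ (i : ℕ) (_ : i < j), MeasurableSpace.comap (fun u : ℕ → ℕ → I => u n i) inferInstance

lemma generated_antitone {Ω : Type*} {S : ℕ → Type*} [∀ n, MeasurableSpace (S n)]
    (Y : (n : ℕ) → Ω → S n) : Antitone (generated Y) := fun _ _ h =>
  iSup₂_le fun m hm => le_iSup₂_of_le m (h.trans hm) le_rfl

lemma generated_le {Ω : Type*} [mΩ : MeasurableSpace Ω] {S : ℕ → Type*}
    [∀ n, MeasurableSpace (S n)] {Y : (n : ℕ) → Ω → S n} (hY : ∀ n, Measurable (Y n)) (n : ℕ) :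
    generated Y n ≤ mΩ :=
  iSup₂_le fun m _ => (hY m).comap_le

lemma measurable_generated {Ω : Type*} {S : ℕ → Type*} [∀ n, MeasurableSpace (S n)]
    (Y : (n : ℕ) → Ω → S n) {n m : ℕ} (h : n ≤ m) : Measurable[generated Y n] (Y m) :=
  measurable_iff_comap_le.2 (le_iSup₂_of_le m h le_rfl)

lemma noiseFiltration_le (n : ℕ) : noiseFiltration n ≤ MeasurableSpace.pi :=
  generated_le (fun n => measurable_pi_apply n) n

lemma noiseBelow_le (n j : ℕ) : noiseBelow n j ≤ noiseFiltration n :=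
  sup_le (generated_antitone _ (Nat.le_succ n)) <| iSup₂_le fun i _ =>
    measurable_iff_comap_le.1 <|
      (measurable_pi_apply i).comp (measurable_generated (fun n (u : ℕ → ℕ → I) => u n) le_rfl)

lemma noiseBelow_mono (n : ℕ) : Monotone (noiseBelow n) := fun _ _ h =>
  sup_le_sup le_rfl <| iSup₂_le fun i hi => le_iSup₂_of_le i (hi.trans_le h) le_rfl

lemma noiseFiltration_le_noiseBelow (n j : ℕ) : noiseFiltration (n + 1) ≤ noiseBelow n j :=
  le_sup_left

lemma measurable_noiseBelow {n i j : ℕ} (h : i < j) :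
    Measurable[noiseBelow n j] (fun u : ℕ → ℕ → I => u n i) :=
  measurable_iff_comap_le.2 <| le_sup_of_le_right <| le_iSup₂_of_le i h le_rfl

lemma map_noise_eval (n j : ℕ) : noise.map (fun u => u n j) = volume := by
  have h : (fun u : ℕ → ℕ → I => u n j) = (fun x : ℕ → I => x j) ∘ fun u => u n := rfl
  rw [h, ← Measure.map_map (measurable_pi_apply j) (measurable_pi_apply n), noise,
    Measure.infinitePi_map_eval, Measure.infinitePi_map_eval]

lemma hasCondLaw_noise (n j : ℕ) :
    HasCondLaw noise (noiseBelow n j) (fun u => u n j) (fun _ => (volume : Measure I)) := by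
  have hm : Measurable fun u : ℕ → ℕ → I => u n j := by fun_prop
  have hind : iIndepFun (fun (p : ℕ × ℕ) (u : ℕ → ℕ → I) => u p.1 p.2) noise :=
    iIndepFun_uncurry_infinitePi' (X := fun _ _ (x : I) => x) (fun _ _ => volume)
      (fun _ _ => measurable_id)
  have hdisj : Disjoint {p : ℕ × ℕ | n < p.1 ∨ p.1 = n ∧ p.2 < j} {(n, j)} := by
    rw [Set.disjoint_singleton_right]
    simp
  have hmp : ∀ p : ℕ × ℕ, Measurable fun u : ℕ → ℕ → I => u p.1 p.2 := fun p => by fun_prop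
  have h := indep_iSup_of_disjoint (fun p => (hmp p).comap_le) hind.iIndep hdisj
  rw [← map_noise_eval n j]
  refine hasCondLaw_of_indep ((noiseBelow_le n j).trans (noiseFiltration_le n)) hm ?_
  refine indep_of_indep_of_le_left (indep_of_indep_of_le_right h ?_) ?_
  · exact le_iSup₂_of_le (n, j) rfl le_rfl
  · refine sup_le (iSup₂_le fun m hm => ?_) (iSup₂_le fun i hi => ?_)
    · rw [MeasurableSpace.pi, MeasurableSpace.comap_iSup]
      refine iSup_le fun i => ?_
      rw [MeasurableSpace.comap_comp]
      exact le_iSup₂_of_le (m, i) (Or.inl hm) le_rfl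
    · exact le_iSup₂_of_le (n, i) (Or.inr ⟨rfl, hi⟩) le_rfl

end Noise

/-! ### Approximating chains driven by the noise -/

section Ladder

variable {E : Type*}

/-- Run a recursion forward in time from time `-N`: the values up to time `-N` are given by
`init`, and `step n` computes the value at time `-n` from the value at time `-(n + 1)`. -/
def runFrom {α : Type*} (N : ℕ) (init : ℕ → α) (step : ℕ → α → α) (n : ℕ) : α :=
  if n < N then step n (runFrom N init step (n + 1)) else init n
termination_by N - n

/-- A sequence of processes driven by the noise. Level `j` is a sequence of fresh draws `s n` up
to time `-T j`. From then on level `j + 1` is driven by `c j n`, whose arguments are the values of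
level `j` at times `-(n + 1)` and `-n`, and its own value at time `-(n + 1)`. -/
def ladder (T : ℕ → ℕ) (s : ℕ → I → E) (c : ℕ → ℕ → (E × E) × E → I → E) :
    ℕ → ℕ → (ℕ → ℕ → I) → E
  | 0, n, u => s n (u n 0)
  | j + 1, n, u => runFrom (T (j + 1)) (fun n => s n (u n (j + 1)))
      (fun n x => c j n ((ladder T s c j (n + 1) u, x), ladder T s c j n u) (u n (j + 1))) n

/-- Induction forward in time, starting from all sufficiently remote times. -/
lemma downward_induction {p : ℕ → Prop} (N : ℕ) (h0 : ∀ n, N ≤ n → p n)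
    (hs : ∀ n < N, p (n + 1) → p n) (n : ℕ) : p n := by
  rcases le_total N n with h | h
  · exact h0 n h
  · exact Nat.decreasingInduction' (fun k hk _ => hs k hk) h (h0 N le_rfl)

variable {T : ℕ → ℕ} {s : ℕ → I → E} {c : ℕ → ℕ → (E × E) × E → I → E}

lemma ladder_of_le {j n : ℕ} (h : T j ≤ n) : ladder T s c j n = fun u => s n (u n j) := by
  funext u
  cases j with
  | zero => rfl
  | succ j => rw [ladder, runFrom, if_neg (not_lt.2 h)]

lemma ladder_succ_of_lt {j n : ℕ} (h : n < T (j + 1)) :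
    ladder T s c (j + 1) n = fun u =>
      c j n ((ladder T s c j (n + 1) u, ladder T s c (j + 1) (n + 1) u), ladder T s c j n u)
        (u n (j + 1)) := by
  funext u
  rw [ladder, runFrom, if_pos h]
  rfl

variable [MeasurableSpace E]

lemma measurable_ladder (hs : ∀ n, Measurable (s n))
    (hc : ∀ j n, Measurable (Function.uncurry (c j n))) (j n : ℕ) :
    Measurable[noiseBelow n (j + 1)] (ladder T s c j n) := by
  induction j generalizing n with
  | zero =>
    rw [show ladder T s c 0 n = fun u => s n (u n 0) from rfl]
    exact (hs n).comp (measurable_noiseBelow Nat.zero_lt_one)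
  | succ j ih =>
    refine downward_induction (p := fun n => Measurable[noiseBelow n (j + 1 + 1)]
      (ladder T s c (j + 1) n)) (T (j + 1)) (fun n hn => ?_) (fun n hn hi => ?_) n
    · rw [ladder_of_le hn]
      exact (hs n).comp (measurable_noiseBelow (Nat.lt_succ_self _))
    · rw [ladder_succ_of_lt hn]
      have hle : ∀ i, noiseBelow (n + 1) i ≤ noiseBelow n (j + 2) := fun i =>
        (noiseBelow_le _ _).trans (noiseFiltration_le_noiseBelow _ _)
      have h1 := (ih (n + 1)).mono (hle _) le_rfl
      have h2 := hi.mono (hle _) le_rfl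
      have h3 := (ih n).mono (noiseBelow_mono n (Nat.le_succ (j + 1))) le_rfl
      exact (hc j n).comp
        (((h1.prodMk h2).prodMk h3).prodMk (measurable_noiseBelow (Nat.lt_succ_self (j + 1))))

lemma measurable_ladder_noiseFiltration (hs : ∀ n, Measurable (s n))
    (hc : ∀ j n, Measurable (Function.uncurry (c j n))) (j n : ℕ) :
    Measurable[noiseFiltration n] (ladder T s c j n) :=
  (measurable_ladder hs hc j n).mono (noiseBelow_le _ _) le_rfl

lemma measurable_ladder_pi (hs : ∀ n, Measurable (s n))
    (hc : ∀ j n, Measurable (Function.uncurry (c j n))) (j n : ℕ) :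
    Measurable (ladder T s c j n) :=
  (measurable_ladder_noiseFiltration hs hc j n).mono (noiseFiltration_le n) le_rfl

end Ladder

/-! ### The law of the approximating chains -/

section LadderLaw

variable {E : Type*} [MeasurableSpace E] [StandardBorelSpace E] [Nonempty E]

/-- The draws `s` and `c` realise the following chains: `s n` has law `ν n`; level `j + 1` moves
with the kernels `P` until time `-T j`, then it is coupled with level `j` by means of `Λ`. The
coupling `Λ n` has the right marginals on the set `A n`, which carries `ν (n + 1)`, and the laws
`ν n` are transported by `P`. -/
structure IsLadder (ν : ℕ → Measure E) (P : ℕ → Kernel E E) (Λ : ℕ → Kernel (E × E) (E × E))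
    [∀ n, IsMarkovKernel (Λ n)] (A : ℕ → Set E) (T : ℕ → ℕ) (s : ℕ → I → E)
    (c : ℕ → ℕ → (E × E) × E → I → E) : Prop where
  zero : T 0 = 0
  mono : Monotone T
  measurable_init : ∀ n, Measurable (s n)
  map_init : ∀ n, volume.map (s n) = ν n
  measurable_step : ∀ j n, Measurable (Function.uncurry (c j n))
  map_step_of_lt : ∀ j n, n < T j → ∀ a, volume.map (c j n a) = (Λ n).condKernel a
  map_step_of_le : ∀ j n, T j ≤ n → ∀ a, volume.map (c j n a) = P n a.1.2
  bind_eq : ∀ n, P n ∘ₘ ν (n + 1) = ν n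
  ae_mem : ∀ n, ∀ᵐ x ∂(ν (n + 1)), x ∈ A n
  map_fst : ∀ n, ∀ x ∈ A n, ∀ x' ∈ A n, (Λ n (x, x')).map Prod.fst = P n x
  map_snd : ∀ n, ∀ x ∈ A n, ∀ x' ∈ A n, (Λ n (x, x')).map Prod.snd = P n x'

namespace IsLadder

variable {ν : ℕ → Measure E} {P : ℕ → Kernel E E} {Λ : ℕ → Kernel (E × E) (E × E)}
  [∀ n, IsMarkovKernel (Λ n)] {A : ℕ → Set E} {T : ℕ → ℕ} {s : ℕ → I → E}
  {c : ℕ → ℕ → (E × E) × E → I → E}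

lemma measurable (h : IsLadder ν P Λ A T s c) (j n : ℕ) : Measurable (ladder T s c j n) :=
  measurable_ladder_pi h.measurable_init h.measurable_step j n

lemma measurable_filtration (h : IsLadder ν P Λ A T s c) (j : ℕ) {n m : ℕ} (hnm : n ≤ m) :
    Measurable[noiseFiltration n] (ladder T s c j m) :=
  (measurable_ladder_noiseFiltration h.measurable_init h.measurable_step j m).mono
    (generated_antitone _ hnm) le_rfl

lemma map_of_le (h : IsLadder ν P Λ A T s c) {j n : ℕ} (hn : T j ≤ n) :
    noise.map (ladder T s c j n) = ν n := by
  rw [ladder_of_le hn, ← h.map_init n, ← map_noise_eval n j,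
    Measure.map_map (h.measurable_init n) (by fun_prop)]
  rfl

lemma ae_mem_ladder (h : IsLadder ν P Λ A T s c) {j n : ℕ}
    (hl : noise.map (ladder T s c j (n + 1)) = ν (n + 1)) :
    ∀ᵐ u ∂noise, ladder T s c j (n + 1) u ∈ A n := by
  refine ae_of_ae_map (h.measurable j (n + 1)).aemeasurable (p := fun x => x ∈ A n) ?_
  rw [hl]
  exact h.ae_mem n

lemma hasCondLaw_succ_of_lt (h : IsLadder ν P Λ A T s c) {j n : ℕ} (hn : n < T j) :
    HasCondLaw noise (noiseBelow n (j + 1)) (ladder T s c (j + 1) n) (fun u =>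
      (Λ n).condKernel ((ladder T s c j (n + 1) u, ladder T s c (j + 1) (n + 1) u),
        ladder T s c j n u)) := by
  rw [ladder_succ_of_lt (hn.trans_le (h.mono (Nat.le_succ j)))]
  refine (hasCondLaw_noise n (j + 1)).sample (c := c j n) (κ := (Λ n).condKernel) (A := fun u =>
    ((ladder T s c j (n + 1) u, ladder T s c (j + 1) (n + 1) u), ladder T s c j n u)) ?_
    (h.measurable_step j n) (h.map_step_of_lt j n hn)
  have hle := noiseFiltration_le_noiseBelow n (j + 1)
  exact (((h.measurable_filtration j le_rfl).mono hle le_rfl).prodMk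
    ((h.measurable_filtration (j + 1) le_rfl).mono hle le_rfl)).prodMk
    (measurable_ladder h.measurable_init h.measurable_step j n)

lemma hasCondLaw_succ_of_le (h : IsLadder ν P Λ A T s c) {j n : ℕ} (hn : T j ≤ n)
    (hn' : n < T (j + 1)) :
    HasCondLaw noise (noiseFiltration (n + 1)) (ladder T s c (j + 1) n)
      (fun u => P n (ladder T s c (j + 1) (n + 1) u)) := by
  have hle := noiseFiltration_le_noiseBelow n (j + 1)
  have key : HasCondLaw noise (noiseBelow n (j + 1)) (ladder T s c (j + 1) n)
      (fun u => P n (ladder T s c (j + 1) (n + 1) u)) := by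
    rw [ladder_succ_of_lt hn']
    refine (hasCondLaw_noise n (j + 1)).sample (c := c j n)
      (κ := (P n).comap (fun a : (E × E) × E => a.1.2) (by fun_prop)) (A := fun u =>
      ((ladder T s c j (n + 1) u, ladder T s c (j + 1) (n + 1) u), ladder T s c j n u)) ?_
      (h.measurable_step j n) (h.map_step_of_le j n hn)
    exact (((h.measurable_filtration j le_rfl).mono hle le_rfl).prodMk
      ((h.measurable_filtration (j + 1) le_rfl).mono hle le_rfl)).prodMk
      (measurable_ladder h.measurable_init h.measurable_step j n)
  intro θ hθ
  exact key θ (hθ.mono (sup_le_sup (MeasurableSpace.comap_mono hle) le_rfl) le_rfl)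

/-- While level `j` is a Markov chain, levels `j` and `j + 1` form a chain moving with `Λ`. -/
lemma hasCondLaw_pair_aux (h : IsLadder ν P Λ A T s c) {j n : ℕ} (hn : n < T j)
    (hl : noise.map (ladder T s c j (n + 1)) = ν (n + 1))
    (hl' : noise.map (ladder T s c (j + 1) (n + 1)) = ν (n + 1))
    (hM : HasCondLaw noise (noiseFiltration (n + 1)) (ladder T s c j n)
      (fun u => P n (ladder T s c j (n + 1) u))) :
    HasCondLaw noise (noiseFiltration (n + 1))
      (fun u => (ladder T s c j n u, ladder T s c (j + 1) n u))
      (fun u => Λ n (ladder T s c j (n + 1) u, ladder T s c (j + 1) (n + 1) u)) := by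
  refine hM.prodMk_of_condKernel (noiseFiltration_le_noiseBelow n (j + 1))
    (h.measurable_filtration j le_rfl) (h.measurable_filtration (j + 1) le_rfl)
    (measurable_ladder h.measurable_init h.measurable_step j n) (h.hasCondLaw_succ_of_lt hn) ?_
  filter_upwards [h.ae_mem_ladder hl, h.ae_mem_ladder hl'] with u hu hu'
  exact h.map_fst n _ hu _ hu'

/-- Every level has the marginal laws `ν` and, from time `-T j` on, moves with the kernels `P`
relative to the filtration of the noise. -/
lemma map_and_hasCondLaw (h : IsLadder ν P Λ A T s c) (j : ℕ) : ∀ n,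
    noise.map (ladder T s c j n) = ν n ∧
    (n < T j → HasCondLaw noise (noiseFiltration (n + 1)) (ladder T s c j n)
      (fun u => P n (ladder T s c j (n + 1) u))) := by
  induction j with
  | zero =>
    intro n
    have hn : T 0 ≤ n := by rw [h.zero]; exact Nat.zero_le n
    exact ⟨h.map_of_le hn, fun h' => absurd h' (not_lt.2 hn)⟩
  | succ j ih =>
    refine downward_induction (T (j + 1))
      (fun n hn => ⟨h.map_of_le hn, fun h' => absurd h' (not_lt.2 hn)⟩) fun n hn hi => ?_
    have key : HasCondLaw noise (noiseFiltration (n + 1)) (ladder T s c (j + 1) n)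
        (fun u => P n (ladder T s c (j + 1) (n + 1) u)) := by
      rcases lt_or_ge n (T j) with hj | hj
      · have hp := h.hasCondLaw_pair_aux hj (ih (n + 1)).1 hi.1 ((ih n).2 hj)
        refine hp.snd.congr ?_
        filter_upwards [h.ae_mem_ladder (ih (n + 1)).1, h.ae_mem_ladder hi.1] with u hu hu'
        exact h.map_snd n _ hu _ hu'
      · exact h.hasCondLaw_succ_of_le hj hn
    refine ⟨?_, fun _ => key⟩
    rw [key.map_eq (h.measurable (j + 1) n) (h.measurable (j + 1) (n + 1)), hi.1, h.bind_eq]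

lemma map_eq (h : IsLadder ν P Λ A T s c) (j n : ℕ) : noise.map (ladder T s c j n) = ν n :=
  (h.map_and_hasCondLaw j n).1

lemma hasCondLaw (h : IsLadder ν P Λ A T s c) {j n : ℕ} (hn : n < T j) :
    HasCondLaw noise (noiseFiltration (n + 1)) (ladder T s c j n)
      (fun u => P n (ladder T s c j (n + 1) u)) :=
  (h.map_and_hasCondLaw j n).2 hn

lemma hasCondLaw_pair (h : IsLadder ν P Λ A T s c) {j n : ℕ} (hn : n < T j) :
    HasCondLaw noise (noiseFiltration (n + 1))
      (fun u => (ladder T s c j n u, ladder T s c (j + 1) n u))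
      (fun u => Λ n (ladder T s c j (n + 1) u, ladder T s c (j + 1) (n + 1) u)) :=
  h.hasCondLaw_pair_aux hn (h.map_eq _ _) (h.map_eq _ _) (h.hasCondLaw hn)

/-- If the couplings preserve an order relation between real observables of the two
coordinates, then so do two consecutive levels, from the time when the lower one starts. -/
lemma ae_order (h : IsLadder ν P Λ A T s c) {f : E → ℝ} (hf : Measurable f)
    (hΛ : ∀ n, ∀ x ∈ A n, ∀ x' ∈ A n, ∀ᵐ y ∂(Λ n (x, x')),
      (f x ≤ f x' → f y.1 ≤ f y.2) ∧ (f x' ≤ f x → f y.2 ≤ f y.1)) (j n : ℕ) (hn : n ≤ T j) :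
    ∀ᵐ u ∂noise,
      (f (ladder T s c j (T j) u) ≤ f (ladder T s c (j + 1) (T j) u) →
        f (ladder T s c j n u) ≤ f (ladder T s c (j + 1) n u)) ∧
      (f (ladder T s c (j + 1) (T j) u) ≤ f (ladder T s c j (T j) u) →
        f (ladder T s c (j + 1) n u) ≤ f (ladder T s c j n u)) := by
  refine Nat.decreasingInduction' (fun k hk _ ih => ?_) hn (ae_of_all _ fun u => ⟨id, id⟩)
  have hB : MeasurableSet {q : (E × E) × (E × E) |
      (f q.1.1 ≤ f q.1.2 → f q.2.1 ≤ f q.2.2) ∧ (f q.1.2 ≤ f q.1.1 → f q.2.2 ≤ f q.2.1)} := by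
    have h1 : MeasurableSet {q : (E × E) × (E × E) | f q.1.1 ≤ f q.1.2} :=
      measurableSet_le (by fun_prop) (by fun_prop)
    have h2 : MeasurableSet {q : (E × E) × (E × E) | f q.1.2 ≤ f q.1.1} :=
      measurableSet_le (by fun_prop) (by fun_prop)
    have h3 : MeasurableSet {q : (E × E) × (E × E) | f q.2.1 ≤ f q.2.2} :=
      measurableSet_le (by fun_prop) (by fun_prop)
    have h4 : MeasurableSet {q : (E × E) × (E × E) | f q.2.2 ≤ f q.2.1} :=
      measurableSet_le (by fun_prop) (by fun_prop)
    exact (h1.imp h3).inter (h2.imp h4)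
  have hstep := (h.hasCondLaw_pair hk).ae_mem (noiseFiltration_le _)
    ((h.measurable j k).prodMk (h.measurable (j + 1) k))
    (A := fun u => (ladder T s c j (k + 1) u, ladder T s c (j + 1) (k + 1) u))
    ((h.measurable_filtration j le_rfl).prodMk (h.measurable_filtration (j + 1) le_rfl)) hB (by
      filter_upwards [h.ae_mem_ladder (h.map_eq j (k + 1)),
        h.ae_mem_ladder (h.map_eq (j + 1) (k + 1))] with u hu hu'
      exact hΛ k _ hu _ hu')
  filter_upwards [hstep, ih] with u hu hi
  exact ⟨fun h0 => hu.1 (hi.1 h0), fun h0 => hu.2 (hi.2 h0)⟩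

/-- The distance between consecutive levels, measured through an order-preserving bounded
observable `f`. As the order of the two levels is the same at times `-T j` and `-n`, the mean
distance is a difference of two means, hence at most the mean distance between the conditional
means given the value at time `-T j`; these are compared with a constant `a`. -/
lemma lintegral_edist_le [∀ n, IsMarkovKernel (P n)] (h : IsLadder ν P Λ A T s c) {f : E → ℝ}
    (hf : Measurable f) (hf0 : ∀ x, 0 ≤ f x) (hf1 : ∀ x, f x ≤ 1)
    (hΛ : ∀ n, ∀ x ∈ A n, ∀ x' ∈ A n, ∀ᵐ y ∂(Λ n (x, x')),
      (f x ≤ f x' → f y.1 ≤ f y.2) ∧ (f x' ≤ f x → f y.2 ≤ f y.1)) (j n l : ℕ) (hn : n + l = T j)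
    (a : ℝ) :
    ∫⁻ u, edist (f (ladder T s c j n u)) (f (ladder T s c (j + 1) n u)) ∂noise ≤
      2 * ∫⁻ x, ‖∫ y, f y ∂(transition P n l x) - a‖ₑ ∂(ν (n + l)) := by
  set N := n + l with hN
  set g : E → ℝ := fun x => ∫ y, f y ∂(transition P n l x) with hg
  have hgm : Measurable g := measurable_integral_kernel hf
  have hg0 : ∀ x, 0 ≤ g x := fun x => (integral_kernel_mem_Icc hf hf0 hf1 x).1
  have hg1 : ∀ x, g x ≤ 1 := fun x => (integral_kernel_mem_Icc hf hf0 hf1 x).2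
  have hanti : Antitone noiseFiltration := generated_antitone _
  have hTj : T j ≤ T (j + 1) := h.mono (Nat.le_succ j)
  set a₀ : (ℕ → ℕ → I) → ℝ := fun u => f (ladder T s c j n u)
  set b₀ : (ℕ → ℕ → I) → ℝ := fun u => f (ladder T s c (j + 1) n u)
  set a₁ : (ℕ → ℕ → I) → ℝ := fun u => g (ladder T s c j N u)
  set b₁ : (ℕ → ℕ → I) → ℝ := fun u => g (ladder T s c (j + 1) N u)
  have ha₀ : Integrable a₀ noise := integrable_comp_of_mem_Icc hf hf0 hf1 (h.measurable _ _)
  have hb₀ : Integrable b₀ noise := integrable_comp_of_mem_Icc hf hf0 hf1 (h.measurable _ _)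
  have ha₁ : Integrable a₁ noise := integrable_comp_of_mem_Icc hgm hg0 hg1 (h.measurable _ _)
  have hb₁ : Integrable b₁ noise := integrable_comp_of_mem_Icc hgm hg0 hg1 (h.measurable _ _)
  have hset : ∀ i, N ≤ T i → ∀ t, MeasurableSet[noiseFiltration N] t →
      ∫ u in t, f (ladder T s c i n u) ∂noise = ∫ u in t, g (ladder T s c i N u) ∂noise := by
    intro i hi t ht
    exact (hasCondLaw_transition hanti (h.measurable_filtration i le_rfl)
      (fun k hk => h.hasCondLaw (hk.trans_le hi)) l n hN.symm).setIntegral (noiseFiltration_le N)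
      (h.measurable i n) (h.measurable_filtration i le_rfl) ht hf hf0 hf1
  set D : Set (ℕ → ℕ → I) := {u | f (ladder T s c j N u) ≤ f (ladder T s c (j + 1) N u)} with hD
  have hDF : MeasurableSet[noiseFiltration N] D :=
    @measurableSet_le _ _ _ _ _ (noiseFiltration N) _ _ _ _ _
      (hf.comp (h.measurable_filtration j le_rfl))
      (hf.comp (h.measurable_filtration (j + 1) le_rfl))
  have hDm : MeasurableSet D := noiseFiltration_le N _ hDF
  have hord := h.ae_order hf hΛ j n (by omega)
  rw [← hn] at hord
  have hmain : ∫ u, |a₀ u - b₀ u| ∂noise ≤ ∫ u, |a₁ u - b₁ u| ∂noise := by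
    have habs : Integrable (fun u => |a₀ u - b₀ u|) noise := (ha₀.sub hb₀).abs
    have habs₁ : Integrable (fun u => |a₁ u - b₁ u|) noise := (ha₁.sub hb₁).abs
    rw [← integral_add_compl hDm habs, ← integral_add_compl hDm habs₁]
    refine add_le_add ?_ ?_
    · have h1 : ∫ u in D, |a₀ u - b₀ u| ∂noise = ∫ u in D, (b₀ u - a₀ u) ∂noise := by
        refine setIntegral_congr_ae hDm ?_
        filter_upwards [hord] with u hu hD
        rw [abs_sub_comm, abs_of_nonneg (sub_nonneg.2 (hu.1 hD))]
      rw [h1, integral_sub hb₀.integrableOn ha₀.integrableOn,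
        hset j (by omega) D hDF, hset (j + 1) (by omega) D hDF,
        ← integral_sub hb₁.integrableOn ha₁.integrableOn]
      refine integral_mono (hb₁.sub ha₁).integrableOn habs₁.integrableOn fun u => ?_
      simp only
      rw [abs_sub_comm]
      exact le_abs_self _
    · have h1 : ∫ u in Dᶜ, |a₀ u - b₀ u| ∂noise = ∫ u in Dᶜ, (a₀ u - b₀ u) ∂noise := by
        refine setIntegral_congr_ae hDm.compl ?_
        filter_upwards [hord] with u hu hD
        have hD' : ¬ f (ladder T s c j N u) ≤ f (ladder T s c (j + 1) N u) := hD
        rw [abs_of_nonneg (sub_nonneg.2 (hu.2 (not_le.1 hD').le))]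
      rw [h1, integral_sub ha₀.integrableOn hb₀.integrableOn,
        hset j (by omega) _ hDF.compl, hset (j + 1) (by omega) _ hDF.compl,
        ← integral_sub ha₁.integrableOn hb₁.integrableOn]
      exact integral_mono (ha₁.sub hb₁).integrableOn habs₁.integrableOn fun u => le_abs_self _
  have hlaw : ∀ i, ∫⁻ u, ‖g (ladder T s c i N u) - a‖ₑ ∂noise = ∫⁻ x, ‖g x - a‖ₑ ∂(ν N) := by
    intro i
    rw [← h.map_eq i N, lintegral_map (by fun_prop) (h.measurable i N)]
  calc ∫⁻ u, edist (a₀ u) (b₀ u) ∂noise = ENNReal.ofReal (∫ u, |a₀ u - b₀ u| ∂noise) := by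
        rw [ofReal_integral_abs_sub ha₀ hb₀]
        simp only [edist_eq_enorm_sub]
    _ ≤ ENNReal.ofReal (∫ u, |a₁ u - b₁ u| ∂noise) := ENNReal.ofReal_le_ofReal hmain
    _ = ∫⁻ u, ‖a₁ u - b₁ u‖ₑ ∂noise := ofReal_integral_abs_sub ha₁ hb₁
    _ ≤ ∫⁻ u, ‖a₁ u - a‖ₑ + ‖b₁ u - a‖ₑ ∂noise := by
        refine lintegral_mono fun u => ?_
        have : a₁ u - b₁ u = (a₁ u - a) - (b₁ u - a) := by ring
        simp only [this]
        exact enorm_sub_le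
    _ = 2 * ∫⁻ x, ‖g x - a‖ₑ ∂(ν N) := by
        rw [lintegral_add_left' (ha₁.aemeasurable.sub_const a).enorm, hlaw, hlaw, two_mul]

end IsLadder

end LadderLaw

/-! ### The limit of the approximating chains -/

section LimitChain

lemma tail_generated_le {Ω : Type*} [mΩ : MeasurableSpace Ω] {S : ℕ → Type*}
    [∀ n, MeasurableSpace (S n)] {X : (n : ℕ) → Ω → S n} (hX : ∀ n, Measurable (X n)) :
    tail (generated X) ≤ mΩ :=
  (iInf_le _ 0).trans (generated_le hX 0)

/-- Transition kernels pass to almost sure limits of identically distributed variables, without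
any continuity of the kernel. -/
lemma hasCondLaw_of_ae_tendsto {Ω E S : Type*} {m : MeasurableSpace Ω} [mΩ : MeasurableSpace Ω]
    {μ : Measure Ω} [IsProbabilityMeasure μ] [TopologicalSpace E]
    [TopologicalSpace.PseudoMetrizableSpace E] [MeasurableSpace E] [BorelSpace E]
    [TopologicalSpace S] [TopologicalSpace.PseudoMetrizableSpace S] [MeasurableSpace S]
    [BorelSpace S] (hm : m ≤ mΩ) {κ : Kernel E S} [IsMarkovKernel κ] {ν : Measure E} {ρ : Measure S}
    {Y : ℕ → Ω → S} {Y' : Ω → S} {Z : ℕ → Ω → E} {Z' : Ω → E} (hY : ∀ i, Measurable (Y i))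
    (hY' : Measurable Y') (hZ : ∀ i, Measurable[m] (Z i)) (hZ' : Measurable[m] Z')
    (hYlaw : ∀ i, μ.map (Y i) = ρ) (hZlaw : ∀ i, μ.map (Z i) = ν)
    (hYlim : ∀ᵐ ω ∂μ, Tendsto (fun i => Y i ω) atTop (𝓝 (Y' ω)))
    (hZlim : ∀ᵐ ω ∂μ, Tendsto (fun i => Z i ω) atTop (𝓝 (Z' ω)))
    (h : ∀ᶠ i in atTop, HasCondLaw μ m (Y i) (fun ω => κ (Z i ω))) :
    HasCondLaw μ m Y' (fun ω => κ (Z' ω)) := by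
  have hZm : ∀ i, Measurable (Z i) := fun i => (hZ i).mono hm le_rfl
  have hZ'm : Measurable Z' := hZ'.mono hm le_rfl
  have : IsFiniteMeasure ρ := by rw [← hYlaw 0]; infer_instance
  have : IsFiniteMeasure ν := by rw [← hZlaw 0]; infer_instance
  refine hasCondLaw_of_setLIntegral hm hY' κ hZ' fun t ht B hB => ?_
  set f : S → ℝ := B.indicator fun _ => 1 with hf
  have hfm : Measurable f := measurable_const.indicator hB
  have hf0 : ∀ y, 0 ≤ f y := fun y => Set.indicator_nonneg (fun _ _ => zero_le_one) y
  have hf1 : ∀ y, f y ≤ 1 := fun y =>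
    Set.indicator_le' (fun _ _ => le_rfl) (fun _ _ => zero_le_one) y
  set g : E → ℝ := fun x => ∫ y, f y ∂(κ x) with hg
  have hgm : Measurable g := measurable_integral_kernel hfm
  have hg0 : ∀ x, 0 ≤ g x := fun x => (integral_kernel_mem_Icc hfm hf0 hf1 x).1
  have hg1 : ∀ x, g x ≤ 1 := fun x => (integral_kernel_mem_Icc hfm hf0 hf1 x).2
  have h1 := tendsto_setIntegral_of_L1 _
    (integrable_comp_of_mem_Icc hfm hf0 hf1 hY').aestronglyMeasurable
    (Eventually.of_forall fun i => integrable_comp_of_mem_Icc hfm hf0 hf1 (hY i))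
    (tendsto_lintegral_enorm_sub_comp hY hY' (Eventually.of_forall hYlaw) hYlim hfm
      (integrable_comp_of_mem_Icc hfm hf0 hf1 measurable_id)) t
  have h2 := tendsto_setIntegral_of_L1 _
    (integrable_comp_of_mem_Icc hgm hg0 hg1 hZ'm).aestronglyMeasurable
    (Eventually.of_forall fun i => integrable_comp_of_mem_Icc hgm hg0 hg1 (hZm i))
    (tendsto_lintegral_enorm_sub_comp hZm hZ'm (Eventually.of_forall hZlaw) hZlim hgm
      (integrable_comp_of_mem_Icc hgm hg0 hg1 measurable_id)) t
  have h3 : ∫ ω in t, f (Y' ω) ∂μ = ∫ ω in t, g (Z' ω) ∂μ := by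
    refine tendsto_nhds_unique (h1.congr' ?_) h2
    filter_upwards [h] with i hi
    exact hi.setIntegral hm (hY i) (hZ i) ht hfm hf0 hf1
  have h4 : ∫ ω in t, f (Y' ω) ∂μ = (μ (t ∩ Y' ⁻¹' B)).toReal := by
    have : (fun ω => f (Y' ω)) = (Y' ⁻¹' B).indicator fun _ => 1 := by
      funext ω; simp [hf, Set.indicator, Set.mem_preimage]; rfl
    rw [this, integral_indicator (hY' hB), Measure.restrict_restrict (hY' hB), setIntegral_const,
      Set.inter_comm]
    simp [measureReal_def]
  have h5 : ∫ ω in t, g (Z' ω) ∂μ = (∫⁻ ω in t, κ (Z' ω) B ∂μ).toReal := by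
    have hκm : Measurable fun ω => κ (Z' ω) B := (κ.measurable_coe hB).comp hZ'm
    rw [← integral_toReal hκm.aemeasurable (ae_of_all _ fun ω => measure_lt_top _ _)]
    refine integral_congr_ae (ae_of_all _ fun ω => ?_)
    simp [hg, hf, integral_indicator hB, measureReal_def]
  rw [h4, h5] at h3
  refine (ENNReal.toReal_eq_toReal_iff' (measure_ne_top _ _) ?_).1 h3
  refine ne_top_of_le_ne_top (measure_ne_top μ t) ?_
  calc ∫⁻ ω in t, κ (Z' ω) B ∂μ ≤ ∫⁻ _ in t, 1 ∂μ := lintegral_mono fun ω => prob_le_one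
    _ = μ t := by simp

/-- Times `T j` along which countably many null sequences are eventually below `2⁻ʲ`. -/
lemma exists_strictMono_le_geometric {α : Type*} [Countable α] {δ : α → ℕ → ℝ≥0∞}
    (hδ : ∀ p, Tendsto (δ p) atTop (𝓝 0)) :
    ∃ T : ℕ → ℕ, T 0 = 0 ∧ StrictMono T ∧
      ∀ p, ∀ᶠ j in atTop, δ p (T j) ≤ ENNReal.ofReal ((1 / 2) ^ j) := by
  obtain ⟨e, he⟩ := exists_injective_nat α
  have hfin : ∀ j : ℕ, {p | e p ≤ j}.Finite := fun j => (Set.finite_Iic j).preimage he.injOn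
  obtain ⟨φ, hφ, hφδ⟩ := extraction_forall_of_eventually
    (P := fun j N => ∀ p ∈ {p | e p ≤ j}, δ p N ≤ ENNReal.ofReal ((1 / 2) ^ j)) fun j =>
      (hfin j).eventually_all.2 fun p _ =>
        ENNReal.tendsto_nhds_zero.1 (hδ p) _ (ENNReal.ofReal_pos.2 (by positivity))
  refine ⟨fun j => if j = 0 then 0 else φ j, rfl, ?_, fun p => ?_⟩
  · refine strictMono_nat_of_lt_succ fun j => ?_
    have h1 := hφ.id_le (j + 1)
    have h2 := hφ (Nat.lt_succ_self j)
    simp only [id] at h1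
    by_cases hj : j = 0
    · simp [hj] at h1 ⊢; omega
    · simpa [hj] using h2
  · filter_upwards [eventually_ge_atTop (max (e p) 1)] with j hj
    have hj0 : j ≠ 0 := by have := le_max_right (e p) 1; omega
    simp only [hj0, if_false]
    exact hφδ j p ((le_max_left _ _).trans hj)

variable {Ω ι : Type*} [mΩ : MeasurableSpace Ω] {μ : Measure Ω} [IsProbabilityMeasure μ]
  [Countable ι]
  {X : ℕ → Ω → (ι → ℝ)} {P : ℕ → Kernel (ι → ℝ) (ι → ℝ)}

/-- If the law of `X n` given the tail is deterministic, then the mean of a bounded function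
of `X n` given the value at time `-N` converges to a constant as `N → ∞`. -/
lemma tendsto_lintegral_transition_sub [∀ n, IsMarkovKernel (P n)] (hX : ∀ n, Measurable (X n))
    (hM : ∀ n, HasCondLaw μ (generated X (n + 1)) (X n) (fun ω => P n (X (n + 1) ω))) {n : ℕ}
    (hb : ∀ᵐ ω ∂μ, condLaw μ (tail (generated X)) (X n) ω = μ.map (X n))
    {f : (ι → ℝ) → ℝ} (hf : Measurable f) (hf0 : ∀ x, 0 ≤ f x) (hf1 : ∀ x, f x ≤ 1) :
    Tendsto (fun N => ∫⁻ x, ‖∫ y, f y ∂(transition P n (N - n) x) - ∫ y, f y ∂(μ.map (X n))‖ₑ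
      ∂(μ.map (X N))) atTop (𝓝 0) := by
  have hanti := generated_antitone X
  have := Measure.isProbabilityMeasure_map (μ := μ) (hX n).aemeasurable
  have hlim := tendsto_lintegral_condExp_sub_const hanti (generated_le hX) (hf.comp (hX n))
    (fun ω => hf0 _) (fun ω => hf1 _) (c := ∫ y, f y ∂(μ.map (X n))) (fun t ht => by
      have htl := tail_generated_le hX
      have h1 : HasCondLaw μ (tail (generated X)) (X n)
          (fun _ => Kernel.const Unit (μ.map (X n)) ()) :=
        (hasCondLaw_condLaw htl (hX n)).congr hb
      have h2 := h1.setIntegral htl (hX n) (A := fun _ => ()) (@measurable_const _ _ _ (_) _)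
        ht hf hf0 hf1
      refine h2.trans ?_
      simp [mul_comm])
  refine hlim.congr' ?_
  filter_upwards [eventually_ge_atTop n] with N hN
  have hXN : Measurable[generated X N] (X N) := measurable_generated X le_rfl
  have h1 := (hasCondLaw_transition (N := N) hanti hXN (fun k _ => hM k) (N - n) n
    (by omega)).condExp_eq (generated_le hX N) (hX n) hXN hf hf0 hf1
  have hgm := measurable_integral_kernel (κ := transition P n (N - n)) hf
  rw [lintegral_map (by fun_prop) (hX N)]
  refine lintegral_congr_ae ?_
  filter_upwards [h1] with ω hω
  rw [hω]
  rfl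

/-- On the space of the noise there is a copy of the chain that is adapted to the filtration of
the noise and moves with the kernels `P` relative to that filtration. -/
theorem exists_adapted_copy (hX : ∀ n, Measurable (X n)) [∀ n, IsMarkovKernel (P n)]
    (hM : ∀ n, HasCondLaw μ (generated X (n + 1)) (X n) (fun ω => P n (X (n + 1) ω)))
    (hmono : IsMonotonic μ X P)
    (hb : ∀ n, ∀ᵐ ω ∂μ, condLaw μ (tail (generated X)) (X n) ω = μ.map (X n)) :
    ∃ X' : ℕ → (ℕ → ℕ → I) → (ι → ℝ), (∀ n, Measurable[noiseFiltration n] (X' n)) ∧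
      (∀ n, noise.map (X' n) = μ.map (X n)) ∧
      ∀ n, HasCondLaw noise (noiseFiltration (n + 1)) (X' n) (fun u => P n (X' (n + 1) u)) := by
  have hprob : ∀ n, IsProbabilityMeasure (μ.map (X n)) := fun n =>
    Measure.isProbabilityMeasure_map (hX n).aemeasurable
  choose Λ hΛmarkov hΛ using hmono
  set f : ι → (ι → ℝ) → ℝ := fun k x => (x k).sigmoid with hfdef
  have hsig : Measurable Real.sigmoid := continuous_sigmoid.measurable
  have hf : ∀ k, Measurable (f k) := fun k => hsig.comp (measurable_pi_apply k)
  have hf0 : ∀ k x, 0 ≤ f k x := fun k x => Real.sigmoid_nonneg _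
  have hf1 : ∀ k x, f k x ≤ 1 := fun k x => Real.sigmoid_le_one _
  obtain ⟨T, hT0, hTmono, hTδ⟩ := exists_strictMono_le_geometric (α := ℕ × ι)
    (δ := fun p N => 2 * ∫⁻ x, ‖∫ y, f p.2 y ∂(transition P p.1 (N - p.1) x)
      - ∫ y, f p.2 y ∂(μ.map (X p.1))‖ₑ ∂(μ.map (X N))) (fun p => by
      simpa using ENNReal.Tendsto.const_mul (a := 2) (tendsto_lintegral_transition_sub hX hM
        (hb p.1) (hf p.2) (hf0 p.2) (hf1 p.2)) (Or.inr (by simp)))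
  choose s hsm hsmap using fun n => Measure.exists_measurable_map_eq (μ.map (X n))
  have hker : ∀ j n, ∃ c : ((ι → ℝ) × (ι → ℝ)) × (ι → ℝ) → I → (ι → ℝ),
      Measurable (Function.uncurry c) ∧
      (n < T j → ∀ a, volume.map (c a) = (Λ n).condKernel a) ∧
      (T j ≤ n → ∀ a, volume.map (c a) = P n a.1.2) := by
    intro j n
    rcases lt_or_ge n (T j) with hn | hn
    · obtain ⟨c, hc, hcm⟩ := (Λ n).condKernel.exists_measurable_map_eq_unitInterval
      exact ⟨c, hc, fun _ => hcm, fun h => absurd h (not_le.2 hn)⟩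
    · obtain ⟨c, hc, hcm⟩ := ((P n).comap
        (fun a : ((ι → ℝ) × (ι → ℝ)) × (ι → ℝ) => a.1.2)
        (by fun_prop)).exists_measurable_map_eq_unitInterval
      exact ⟨c, hc, fun h => absurd hn (not_le.2 h), fun _ => hcm⟩
  choose c hcm hclt hcle using hker
  have hL : IsLadder (fun n => μ.map (X n)) P Λ (fun n => (μ.map (X (n + 1))).support) T s c :=
    { zero := hT0
      mono := hTmono.monotone
      measurable_init := hsm
      map_init := hsmap
      measurable_step := hcm
      map_step_of_lt := hclt
      map_step_of_le := hcle
      bind_eq := fun n => ((hM n).map_eq (hX n) (hX (n + 1))).symm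
      ae_mem := fun n => Measure.support_mem_ae
      map_fst := fun n x hx x' hx' => (hΛ n x hx x' hx').1
      map_snd := fun n x hx x' hx' => (hΛ n x hx x' hx').2.1 }
  have hord : ∀ k n, ∀ x ∈ (μ.map (X (n + 1))).support, ∀ x' ∈ (μ.map (X (n + 1))).support,
      ∀ᵐ y ∂(Λ n (x, x')), (f k x ≤ f k x' → f k y.1 ≤ f k y.2) ∧
        (f k x' ≤ f k x → f k y.2 ≤ f k y.1) := by
    intro k n x hx x' hx'
    simp only [hfdef, Real.sigmoid_le_iff]
    have h := (hΛ n x hx x' hx').2.2 k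
    have h1 : ∀ᵐ y ∂(Λ n (x, x')), x k ≤ x' k → y.1 k ≤ y.2 k := by
      by_cases hk : x k ≤ x' k
      · filter_upwards [h.1 hk] with y hy _ using hy
      · exact ae_of_all _ fun y hy => absurd hy hk
    have h2 : ∀ᵐ y ∂(Λ n (x, x')), x' k ≤ x k → y.2 k ≤ y.1 k := by
      by_cases hk : x' k ≤ x k
      · filter_upwards [h.2 hk] with y hy _ using hy
      · exact ae_of_all _ fun y hy => absurd hy hk
    filter_upwards [h1, h2] with y h1 h2 using ⟨h1, h2⟩
  have hcoord : ∀ n k, ∀ᵐ u ∂noise, ∃ l, Tendsto (fun j => ladder T s c j n u k) atTop (𝓝 l) := by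
    intro n k
    refine ae_exists_tendsto_of_sigmoid (ρ := (μ.map (X n)).map fun x => x k)
      (fun j => (measurable_pi_apply k).comp (hL.measurable j n))
      (Eventually.of_forall fun j => ?_) ?_
    · rw [← hL.map_eq j n, Measure.map_map (by fun_prop) (hL.measurable j n)]
      rfl
    · refine ae_exists_tendsto_of_lintegral_edist_le
        (fun j => (hf k).comp (hL.measurable j n)) ?_
      filter_upwards [hTδ (n, k), eventually_ge_atTop n] with j hj hnj
      have hnT : n ≤ T j := hnj.trans (hTmono.id_le j)
      have := hL.lintegral_edist_le (hf k) (hf0 k) (hf1 k) (hord k) j n (T j - n) (by omega)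
        (∫ y, f k y ∂(μ.map (X n)))
      rw [show n + (T j - n) = T j by omega] at this
      exact this.trans hj
  set X' : ℕ → (ℕ → ℕ → I) → (ι → ℝ) :=
    fun n u k => limsup (fun j => ladder T s c j n u k) atTop with hX'
  have hX'm : ∀ n, Measurable[noiseFiltration n] (X' n) := fun n =>
    @measurable_pi_lambda _ _ _ (noiseFiltration n) _ _ fun k => Measurable.limsup fun j =>
      (measurable_pi_apply k).comp (hL.measurable_filtration j le_rfl)
  have hlim : ∀ n, ∀ᵐ u ∂noise, Tendsto (fun j => ladder T s c j n u) atTop (𝓝 (X' n u)) := by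
    intro n
    filter_upwards [ae_all_iff.2 (hcoord n)] with u hu
    refine tendsto_pi_nhds.2 fun k => ?_
    obtain ⟨l, hl⟩ := hu k
    simp only [hX']
    rwa [hl.limsup_eq]
  have hX'pi : ∀ n, Measurable (X' n) := fun n => (hX'm n).mono (noiseFiltration_le n) le_rfl
  refine ⟨X', hX'm, fun n => map_eq_of_ae_tendsto (fun j => hL.measurable j n)
    (hX'pi n).aemeasurable (Eventually.of_forall fun j => hL.map_eq j n) (hlim n), fun n => ?_⟩
  refine hasCondLaw_of_ae_tendsto (noiseFiltration_le _) (fun j => hL.measurable j n) (hX'pi n)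
    (fun j => hL.measurable_filtration j le_rfl) (hX'm (n + 1)) (fun j => hL.map_eq j n)
    (fun j => hL.map_eq j (n + 1)) (hlim n) (hlim (n + 1)) ?_
  filter_upwards [eventually_gt_atTop n] with j hj
  exact hL.hasCondLaw (hj.trans_le (hTmono.id_le j))

end LimitChain

/-! ### The law of a Markov chain -/

section Law

variable {E : Type*} [MeasurableSpace E]

/-- The mean of `φ 0 (Z 0) * ⋯ * φ n (Z n)` given `Z n`, for a chain `Z` with kernels `P`. -/
noncomputable def backward (P : ℕ → Kernel E E) (φ : ℕ → E → ℝ≥0∞) : ℕ → E → ℝ≥0∞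
  | 0 => φ 0
  | n + 1 => fun x => φ (n + 1) x * ∫⁻ y, backward P φ n y ∂(P n x)

lemma measurable_backward {P : ℕ → Kernel E E} {φ : ℕ → E → ℝ≥0∞} (hφ : ∀ n, Measurable (φ n))
    (n : ℕ) : Measurable (backward P φ n) := by
  induction n with
  | zero => exact hφ 0
  | succ n ih => exact (hφ (n + 1)).mul ih.lintegral_kernel

lemma lintegral_prod_eq_backward {Ω : Type*} [mΩ : MeasurableSpace Ω] {μ : Measure Ω}
    {F : ℕ → MeasurableSpace Ω} (hF : Antitone F) {P : ℕ → Kernel E E}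
    {Z : ℕ → Ω → E} (hZ : ∀ n, Measurable[F n] (Z n))
    (h : ∀ n, HasCondLaw μ (F (n + 1)) (Z n) (fun ω => P n (Z (n + 1) ω)))
    {φ : ℕ → E → ℝ≥0∞} (hφ : ∀ n, Measurable (φ n)) (n : ℕ) :
    ∀ W : Ω → ℝ≥0∞, Measurable[F n] W →
      ∫⁻ ω, (∏ i ∈ Finset.range (n + 1), φ i (Z i ω)) * W ω ∂μ
        = ∫⁻ ω, backward P φ n (Z n ω) * W ω ∂μ := by
  induction n with
  | zero => intro W _; simp [backward]
  | succ n ih =>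
    intro W hW
    have hW' : Measurable[F (n + 1)] fun ω => φ (n + 1) (Z (n + 1) ω) * W ω :=
      ((hφ (n + 1)).comp (hZ (n + 1))).mul hW
    have h1 := ih _ (hW'.mono (hF (Nat.le_succ n)) le_rfl)
    have h2 := (h n).lintegral_mul hW' (measurable_backward (P := P) hφ n)
    calc ∫⁻ ω, (∏ i ∈ Finset.range (n + 1 + 1), φ i (Z i ω)) * W ω ∂μ
        = ∫⁻ ω, (∏ i ∈ Finset.range (n + 1), φ i (Z i ω)) *
            (φ (n + 1) (Z (n + 1) ω) * W ω) ∂μ := by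
          refine lintegral_congr fun ω => ?_
          rw [Finset.prod_range_succ, mul_assoc]
      _ = ∫⁻ ω, (φ (n + 1) (Z (n + 1) ω) * W ω) * backward P φ n (Z n ω) ∂μ := by
          rw [h1]
          exact lintegral_congr fun ω => mul_comm _ _
      _ = ∫⁻ ω, backward P φ (n + 1) (Z (n + 1) ω) * W ω ∂μ := by
          rw [h2]
          refine lintegral_congr fun ω => ?_
          simp only [backward]
          ring

/-- The law of a Markov chain is determined by its marginal laws and its transition kernels. -/
lemma map_eq_of_hasCondLaw {Ω Ω' : Type*} [mΩ : MeasurableSpace Ω] [mΩ' : MeasurableSpace Ω']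
    {μ : Measure Ω} {μ' : Measure Ω'} [IsProbabilityMeasure μ] [IsProbabilityMeasure μ']
    {F : ℕ → MeasurableSpace Ω} {F' : ℕ → MeasurableSpace Ω'} (hF : Antitone F)
    (hF' : Antitone F') (hle : ∀ n, F n ≤ mΩ) (hle' : ∀ n, F' n ≤ mΩ') {P : ℕ → Kernel E E}
    {Z : ℕ → Ω → E} {Z' : ℕ → Ω' → E}
    (hZ : ∀ n, Measurable[F n] (Z n)) (hZ' : ∀ n, Measurable[F' n] (Z' n))
    (hlaw : ∀ n, μ.map (Z n) = μ'.map (Z' n))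
    (h : ∀ n, HasCondLaw μ (F (n + 1)) (Z n) (fun ω => P n (Z (n + 1) ω)))
    (h' : ∀ n, HasCondLaw μ' (F' (n + 1)) (Z' n) (fun ω => P n (Z' (n + 1) ω))) :
    μ.map (fun ω n => Z n ω) = μ'.map (fun ω n => Z' n ω) := by
  have hZm : ∀ n, Measurable (Z n) := fun n => (hZ n).mono (hle n) le_rfl
  have hZm' : ∀ n, Measurable (Z' n) := fun n => (hZ' n).mono (hle' n) le_rfl
  have hp : Measurable fun ω n => Z n ω := measurable_pi_lambda _ hZm
  have hp' : Measurable fun ω n => Z' n ω := measurable_pi_lambda _ hZm'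
  have := Measure.isProbabilityMeasure_map (μ := μ) hp.aemeasurable
  have := Measure.isProbabilityMeasure_map (μ := μ') hp'.aemeasurable
  refine ext_of_generate_finite _ (generateFrom_squareCylinders (α := fun _ : ℕ => E)).symm
    (isPiSystem_squareCylinders (fun _ => MeasurableSpace.isPiSystem_measurableSet)
      (fun _ => MeasurableSet.univ)) ?_ (by simp)
  rintro _ ⟨s, t, ht, rfl⟩
  have ht' : ∀ i, MeasurableSet (t i) := fun i => by simpa using ht i (Set.mem_univ i)
  obtain ⟨N, hN⟩ := s.exists_nat_subset_range
  classical
  set φ : ℕ → E → ℝ≥0∞ := fun i => if i ∈ s then (t i).indicator 1 else 1 with hφdef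
  have hφ : ∀ i, Measurable (φ i) := fun i => by
    by_cases hi : i ∈ s
    · simpa [hφdef, hi] using measurable_one.indicator (ht' i)
    · simp only [hφdef, hi, if_false]; exact measurable_one
  have hprod : ∀ x : ℕ → E, ∏ i ∈ Finset.range (N + 1), φ i (x i)
      = ((s : Set ℕ).pi t).indicator (fun _ => 1) x := by
    intro x
    by_cases hx : x ∈ (s : Set ℕ).pi t
    · rw [Set.indicator_of_mem hx]
      refine Finset.prod_eq_one fun i _ => ?_
      by_cases hi : i ∈ s
      · simp [hφdef, hi, hx i hi]
      · simp [hφdef, hi]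
    · rw [Set.indicator_of_notMem hx]
      simp only [Set.mem_pi, not_forall] at hx
      obtain ⟨i, hi, hxi⟩ := hx
      have hi' : i ∈ s := hi
      refine Finset.prod_eq_zero (i := i)
        (Finset.mem_range.2 ((Finset.mem_range.1 (hN hi')).trans (Nat.lt_succ_self N))) ?_
      simp [hφdef, hi', hxi]
  have hcyl : MeasurableSet ((s : Set ℕ).pi t) :=
    MeasurableSet.pi s.countable_toSet fun i _ => ht' i
  have key : ∀ ν : Measure (ℕ → E),
      ν ((s : Set ℕ).pi t) = ∫⁻ x, ∏ i ∈ Finset.range (N + 1), φ i (x i) ∂ν := by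
    intro ν
    rw [← lintegral_indicator_one hcyl]
    exact lintegral_congr fun x => (hprod x).symm
  have hφm : Measurable fun x : ℕ → E => ∏ i ∈ Finset.range (N + 1), φ i (x i) := by fun_prop
  have h1 := lintegral_prod_eq_backward hF hZ h hφ N (fun _ => 1) (@measurable_const _ _ _ (F N) _)
  have h1' := lintegral_prod_eq_backward hF' hZ' h' hφ N (fun _ => 1)
    (@measurable_const _ _ _ (F' N) _)
  have hb := measurable_backward (P := P) hφ N
  simp only [mul_one] at h1 h1'
  rw [key, key, lintegral_map hφm hp, lintegral_map hφm hp', h1, h1',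
    ← lintegral_map hb (hZm N), ← lintegral_map hb (hZm' N), hlaw]

end Law

/-! ### Immersion -/

section Immersion

lemma generated_eq_sup {Ω : Type*} {S : ℕ → Type*} [∀ n, MeasurableSpace (S n)]
    (Y : (n : ℕ) → Ω → S n) (n : ℕ) :
    generated Y n = MeasurableSpace.comap (Y n) inferInstance ⊔ generated Y (n + 1) := by
  refine le_antisymm (iSup₂_le fun m hm => ?_)
    (sup_le (le_iSup₂_of_le n le_rfl le_rfl) (generated_antitone Y (Nat.le_succ n)))
  rcases hm.eq_or_lt with rfl | hm
  · exact le_sup_left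
  · exact le_sup_of_le_right (le_iSup₂_of_le m hm le_rfl)

/-- Conditional independence given `m`, from the existence of a version `g` of the conditional
probability of `s` given a larger sigma-field that is already `m`-measurable. -/
lemma condExp_inter_ae_eq_mul {Ω : Type*} {m m' : MeasurableSpace Ω} [mΩ : MeasurableSpace Ω]
    {μ : Measure Ω} [IsProbabilityMeasure μ] (hmm : m ≤ m') (hm' : m' ≤ mΩ)
    {s : Set Ω} (hs : MeasurableSet s) {g : Ω → ℝ} (hg : Measurable[m] g) (hg0 : ∀ ω, 0 ≤ g ω)
    (hg1 : ∀ ω, g ω ≤ 1)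
    (h : ∀ t, MeasurableSet[m'] t → μ.real (s ∩ t) = ∫ ω in t, g ω ∂μ)
    {t : Set Ω} (ht : MeasurableSet[m'] t) :
    μ⟦s ∩ t | m⟧ =ᵐ[μ] μ⟦s | m⟧ * μ⟦t | m⟧ := by
  have hm : m ≤ mΩ := hmm.trans hm'
  have htm : MeasurableSet t := hm' _ ht
  have hgm : Measurable g := hg.mono hm le_rfl
  have hgi : Integrable g μ := Integrable.of_bound hgm.aestronglyMeasurable 1
    (ae_of_all _ fun ω => by rw [Real.norm_eq_abs, abs_of_nonneg (hg0 ω)]; exact hg1 ω)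
  have hind : ∀ u, MeasurableSet u → Integrable (u.indicator fun _ => (1 : ℝ)) μ :=
    fun u hu => (integrable_const 1).indicator hu
  have hset : ∀ u v : Set Ω, MeasurableSet u →
      ∫ ω in v, u.indicator (fun _ => (1 : ℝ)) ω ∂μ = μ.real (u ∩ v) := fun u v hu => by
    rw [integral_indicator hu, Measure.restrict_restrict hu, setIntegral_const]
    simp
  have h1 : g =ᵐ[μ] μ⟦s | m⟧ :=
    ae_eq_condExp_of_forall_setIntegral_eq hm (hind s hs) (fun _ _ _ => hgi.integrableOn)
      (fun u hu _ => by rw [hset s u hs, h u (hmm _ hu)]) hg.aestronglyMeasurable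
  have hgt : Integrable (g * t.indicator fun _ => (1 : ℝ)) μ := by
    have : (g * t.indicator fun _ => (1 : ℝ)) = t.indicator g := by
      funext ω
      by_cases hω : ω ∈ t <;> simp [hω]
    rw [this]
    exact hgi.indicator htm
  have h2 : μ[g * t.indicator (fun _ => (1 : ℝ)) | m] =ᵐ[μ] g * μ⟦t | m⟧ :=
    condExp_mul_of_stronglyMeasurable_left hg.stronglyMeasurable hgt (hind t htm)
  have h3 : μ[g * t.indicator (fun _ => (1 : ℝ)) | m] =ᵐ[μ] μ⟦s ∩ t | m⟧ := by
    refine ae_eq_condExp_of_forall_setIntegral_eq hm (hind _ (hs.inter htm))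
      (fun _ _ _ => integrable_condExp.integrableOn) (fun u hu _ => ?_)
      stronglyMeasurable_condExp.aestronglyMeasurable
    have htu : MeasurableSet[m'] (t ∩ u) := MeasurableSet.inter ht (hmm _ hu)
    rw [setIntegral_condExp hm hgt hu, hset _ u (hs.inter htm), Set.inter_assoc, h _ htu,
      ← Measure.restrict_restrict htm, ← integral_indicator htm]
    refine integral_congr_ae (ae_of_all _ fun ω => ?_)
    by_cases hω : ω ∈ t <;> simp [hω]
  filter_upwards [h1, h2, h3] with ω h1 h2 h3
  rw [← h3, h2, Pi.mul_apply, Pi.mul_apply, h1]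

/-- The filtration of an adapted process is immersed as soon as the process is a Markov chain
relative to the larger filtration. -/
lemma isImmersed_of_hasCondLaw {Ω : Type*} [mΩ : MeasurableSpace Ω] {μ : Measure Ω}
    [IsProbabilityMeasure μ] {E : Type*} [MeasurableSpace E] {G : ℕ → MeasurableSpace Ω}
    (hG : Antitone G) (hle : ∀ n, G n ≤ mΩ) {P : ℕ → Kernel E E} [∀ n, IsMarkovKernel (P n)]
    {Z : ℕ → Ω → E} (hZ : ∀ n, Measurable[G n] (Z n))
    (h : ∀ n, HasCondLaw μ (G (n + 1)) (Z n) (fun ω => P n (Z (n + 1) ω))) :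
    IsImmersed μ (generated Z) G := by
  have hFG : ∀ n, generated Z n ≤ G n := fun n =>
    iSup₂_le fun m hm => (measurable_iff_comap_le.1 (hZ m)).trans (hG hm)
  refine ⟨hFG, fun n s t hs ht => ?_⟩
  -- an event of the filtration of `Z` at time `-n` is an event for the pair formed by `Z n` and
  -- the past, so that its conditional probability is obtained by integrating a section
  obtain ⟨C, hC, rfl⟩ : ∃ C : Set (Ω × E),
      MeasurableSet[(generated Z (n + 1)).prod inferInstance] C ∧
      (fun ω => (ω, Z n ω)) ⁻¹' C = s := by
    have : generated Z n = MeasurableSpace.comap (fun ω => (ω, Z n ω))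
        ((generated Z (n + 1)).prod inferInstance) := by
      rw [MeasurableSpace.prod, MeasurableSpace.comap_sup, MeasurableSpace.comap_comp,
        MeasurableSpace.comap_comp, generated_eq_sup, sup_comm]
      congr 1
      exact MeasurableSpace.comap_id.symm
    rw [this] at hs
    exact hs
  have hκ : Measurable[generated Z (n + 1)] fun ω => P n (Z (n + 1) ω) (Prod.mk ω ⁻¹' C) := by
    have aux : ∀ {Ω₀ : Type _} [MeasurableSpace Ω₀] {C : Set (Ω₀ × E)} {A : Ω₀ → E},
        Measurable A → MeasurableSet C → Measurable fun ω => P n (A ω) (Prod.mk ω ⁻¹' C) := by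
      intro Ω₀ _ C A hA hC
      exact Kernel.measurable_kernel_prodMk_left (κ := (P n).comap A hA) hC
    exact @aux Ω (generated Z (n + 1)) C _ (measurable_generated Z le_rfl) hC
  have hsm : MeasurableSet ((fun ω => (ω, Z n ω)) ⁻¹' C) :=
    hle n _ (hFG n _ hs)
  refine condExp_inter_ae_eq_mul (g := fun ω => (P n (Z (n + 1) ω)).real (Prod.mk ω ⁻¹' C))
    (hFG (n + 1)) (hle (n + 1)) hsm hκ.ennreal_toReal (fun ω => measureReal_nonneg)
    (fun ω => measureReal_le_one) (fun t ht => ?_) ht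
  have hC' : MeasurableSet[(G (n + 1)).prod inferInstance] C :=
    sup_le_sup (MeasurableSpace.comap_mono (hFG (n + 1))) le_rfl _ hC
  have hθ : Measurable[(G (n + 1)).prod inferInstance]
      ((C ∩ Prod.fst ⁻¹' t).indicator fun _ => (1 : ℝ≥0∞)) := by
    refine (@measurable_const _ _ _ (_) _).indicator ?_
    exact MeasurableSet.inter hC' (@measurable_fst _ _ (G (n + 1)) _ t ht)
  have h1 := h n _ hθ
  have htm := hle (n + 1) _ ht
  have h2 : ∫⁻ ω, (C ∩ Prod.fst ⁻¹' t).indicator (fun _ => (1 : ℝ≥0∞)) (ω, Z n ω) ∂μ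
      = μ ((fun ω => (ω, Z n ω)) ⁻¹' C ∩ t) := by
    rw [← lintegral_indicator_one (hsm.inter htm)]
    rfl
  have h3 : ∫⁻ ω, ∫⁻ y, (C ∩ Prod.fst ⁻¹' t).indicator (fun _ => (1 : ℝ≥0∞)) (ω, y)
      ∂(P n (Z (n + 1) ω)) ∂μ = ∫⁻ ω in t, P n (Z (n + 1) ω) (Prod.mk ω ⁻¹' C) ∂μ := by
    rw [← lintegral_indicator htm]
    refine lintegral_congr fun ω => ?_
    have hsec : MeasurableSet (Prod.mk ω ⁻¹' C) :=
      @measurable_prodMk_left _ _ (generated Z (n + 1)) _ ω C hC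
    by_cases hω : ω ∈ t
    · rw [Set.indicator_of_mem hω, ← lintegral_indicator_one hsec]
      refine lintegral_congr fun y => ?_
      by_cases hy : (ω, y) ∈ C <;> simp [Set.indicator, hω, hy]
    · rw [Set.indicator_of_notMem hω]
      simp [Set.indicator, hω]
  rw [h2, h3] at h1
  rw [measureReal_def, h1, ← integral_toReal (hκ.mono (hFG _ |>.trans (hle _)) le_rfl).aemeasurable
    (ae_of_all _ fun ω => measure_lt_top _ _)]
  rfl

end Immersion

/-! ### Kolmogorovian filtrations -/

section Kolmogorovian

lemma IsKolmogorovian.indep {Ω : Type*} {F : ℕ → MeasurableSpace Ω} {m : MeasurableSpace Ω}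
    [mΩ : MeasurableSpace Ω] {μ : Measure Ω} [IsProbabilityMeasure μ]
    (hle : tail F ≤ mΩ) (h : IsKolmogorovian μ F) : Indep (tail F) m μ := by
  rw [Indep_iff]
  intro t₁ t₂ ht₁ _
  have htm : MeasurableSet t₁ := hle _ ht₁
  rcases h t₁ ht₁ with h0 | h1
  · rw [h0, zero_mul]
    exact measure_mono_null Set.inter_subset_left h0
  · rw [h1, one_mul, Set.inter_comm]
    have hae : ∀ᵐ ω ∂μ, ω ∈ t₁ := (mem_ae_iff_prob_eq_one htm).2 h1
    refine measure_congr ?_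
    filter_upwards [hae] with ω hω
    exact propext ⟨fun h => h.1, fun h => ⟨h, hω⟩⟩

lemma condLaw_ae_eq_of_indep {Ω S : Type*} {m : MeasurableSpace Ω} [mΩ : MeasurableSpace Ω]
    [mS : MeasurableSpace S] [StandardBorelSpace S] [Nonempty S] {μ : Measure Ω}
    [IsProbabilityMeasure μ] (hm : m ≤ mΩ) {Y : Ω → S} (hY : Measurable Y)
    (h : Indep m (mS.comap Y) μ) : ∀ᵐ ω ∂μ, condLaw μ m Y ω = μ.map Y := by
  have key : ∀ {Ω₀ : Type _} [MeasurableSpace Ω₀] {p : Ω → Ω₀} (_ : Measurable p),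
      Indep (MeasurableSpace.comap p inferInstance) (mS.comap Y) μ →
      ∀ᵐ ω ∂μ, condDistrib Y p μ (p ω) = μ.map Y := by
    intro Ω₀ _ p hp hind
    have := Measure.isProbabilityMeasure_map (μ := μ) hY.aemeasurable
    have hprod := (indepFun_iff_map_prod_eq_prod_map_map hp.aemeasurable hY.aemeasurable).1
      ((IndepFun_iff_Indep p Y μ).2 hind)
    have h1 : condDistrib Y p μ =ᵐ[μ.map p] Kernel.const Ω₀ (μ.map Y) :=
      condDistrib_ae_eq_of_measure_eq_compProd p hY.aemeasurable
        (by rw [hprod, Measure.compProd_const])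
    exact ae_of_ae_map hp.aemeasurable h1
  refine @key Ω m id (measurable_id'' hm) ?_
  rw [@MeasurableSpace.comap_id _ m]
  exact h

lemma IsProductType.isKolmogorovian {Ω : Type*} [MeasurableSpace Ω] {μ : Measure Ω}
    {G : ℕ → MeasurableSpace Ω} (h : IsProductType μ G) : IsKolmogorovian μ G := by
  obtain ⟨S, _, _, U, hU, hind, hG⟩ := h
  intro s hs
  refine measure_zero_or_one_of_measurableSet_limsup_atTop (fun n => (hU n).comap_le)
    hind.iIndep ?_
  rw [limsup_eq_iInf_iSup_of_nat]
  have : G = generated U := funext hG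
  rwa [this] at hs

lemma IsKolmogorovian.mono {Ω : Type*} [MeasurableSpace Ω] {μ : Measure Ω}
    {F G : ℕ → MeasurableSpace Ω} (h : IsKolmogorovian μ G) (hFG : ∀ n, F n ≤ G n) :
    IsKolmogorovian μ F := fun s hs => h s (iInf_mono hFG s hs)

lemma generated_eq_comap {Ω : Type*} {S : ℕ → Type*} [∀ n, MeasurableSpace (S n)]
    (Y : (n : ℕ) → Ω → S n) (n : ℕ) : generated Y n =
      MeasurableSpace.comap (fun ω n => Y n ω)
        (generated (fun n (x : (n : ℕ) → S n) => x n) n) := by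
  simp only [generated, MeasurableSpace.comap_iSup, MeasurableSpace.comap_comp]
  rfl

/-- The tail event `s` is, for each `n`, a function of the process up to time `-n`; the
corresponding events for the isomorphic process agree up to null sets, and their lower limit is a
tail event. -/
lemma IsIsomorphic.isKolmogorovian {Ω Ω' : Type*} [MeasurableSpace Ω] [MeasurableSpace Ω']
    {μ : Measure Ω} {μ' : Measure Ω'} {F : ℕ → MeasurableSpace Ω} {F' : ℕ → MeasurableSpace Ω'}
    (h : IsIsomorphic μ F μ' F') (h' : IsKolmogorovian μ' F') : IsKolmogorovian μ F := by
  obtain ⟨S, _, _, Y, Y', hY, hY', hF, hF', hlaw⟩ := h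
  intro s hs
  have hB : ∀ n, ∃ B, MeasurableSet[generated (fun n (x : (n : ℕ) → S n) => x n) n] B ∧
      (fun ω n => Y n ω) ⁻¹' B = s := by
    intro n
    have hsn : MeasurableSet[F n] s := iInf_le F n s hs
    rw [hF, generated_eq_comap] at hsn
    exact hsn
  choose B hBm hBs using hB
  have hBpi : ∀ n, MeasurableSet (B n) := fun n =>
    generated_le (fun n => measurable_pi_apply n) n _ (hBm n)
  have hp : Measurable fun ω n => Y n ω := measurable_pi_lambda _ hY
  have hp' : Measurable fun ω n => Y' n ω := measurable_pi_lambda _ hY'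
  set s' : ℕ → Set Ω' := fun n => (fun ω n => Y' n ω) ⁻¹' B n with hs'
  have hs'F : ∀ n, MeasurableSet[F' n] (s' n) := fun n => by
    rw [hF', generated_eq_comap]
    exact ⟨B n, hBm n, rfl⟩
  have hiff : ∀ n, ∀ᵐ ω ∂μ', ω ∈ s' n ↔ ω ∈ s' 0 := by
    intro n
    have hms : MeasurableSet {x | x ∈ B n ↔ x ∈ B 0} := (hBpi n).iff (hBpi 0)
    have h1 : ∀ᵐ x ∂(μ.map fun ω n => Y n ω), x ∈ B n ↔ x ∈ B 0 := by
      refine (ae_map_iff hp.aemeasurable hms).2 (ae_of_all _ fun ω => ?_)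
      change ω ∈ (fun ω n => Y n ω) ⁻¹' B n ↔ ω ∈ (fun ω n => Y n ω) ⁻¹' B 0
      rw [hBs, hBs]
    rw [hlaw] at h1
    exact ae_of_ae_map hp'.aemeasurable h1
  set t : Set Ω' := ⋃ n, ⋂ m, s' (n + m) with ht
  have htail : MeasurableSet[tail F'] t := by
    have hanti : Antitone F' := by
      rw [show F' = generated Y' from funext hF']
      exact generated_antitone Y'
    rw [tail, MeasurableSpace.measurableSet_iInf]
    intro N
    have : t = ⋃ n, ⋂ m, s' (n + N + m) := by
      ext ω
      simp only [ht, Set.mem_iUnion, Set.mem_iInter]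
      constructor
      · rintro ⟨n, hn⟩
        exact ⟨n, fun m => by rw [add_assoc]; exact hn _⟩
      · rintro ⟨n, hn⟩
        exact ⟨n + N, hn⟩
    rw [this]
    exact MeasurableSet.iUnion fun n => MeasurableSet.iInter fun m =>
      hanti (by omega : N ≤ n + N + m) _ (hs'F _)
  have hts : t =ᵐ[μ'] s' 0 := by
    filter_upwards [ae_all_iff.2 hiff] with ω hω
    refine propext ?_
    change ω ∈ t ↔ ω ∈ s' 0
    simp only [ht, Set.mem_iUnion, Set.mem_iInter, hω]
    simp
  have hμ : μ s = μ' t := by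
    rw [measure_congr hts, ← hBs 0, ← Measure.map_apply hp (hBpi 0), hlaw,
      Measure.map_apply hp' (hBpi 0)]
  rw [hμ]
  exact h' t htail

lemma IsStandard.isKolmogorovian {Ω : Type*} [MeasurableSpace Ω] {μ : Measure Ω}
    {F : ℕ → MeasurableSpace Ω} (h : IsStandard μ F) : IsKolmogorovian μ F := by
  obtain ⟨Ω', _, μ', _, F', G, hiso, hG, himm⟩ := h
  exact hiso.isKolmogorovian (hG.isKolmogorovian.mono himm.1)

end Kolmogorovian

/-! ### Standardness -/

lemma isProductType_noiseFiltration : IsProductType noise noiseFiltration :=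
  ⟨fun _ => ℕ → I, fun _ => inferInstance, fun _ => inferInstance, fun n u => u n,
    fun n => measurable_pi_apply n,
    iIndepFun_infinitePi (X := fun _ (x : ℕ → I) => x) (fun _ => measurable_id), fun _ => rfl⟩

/-- A monotonic Markov chain whose marginal laws are not changed by conditioning on the tail
generates a standard filtration. -/
theorem isStandard_generated {Ω : Type*} [MeasurableSpace Ω] {μ : Measure Ω}
    [IsProbabilityMeasure μ] {ι : Type} [Countable ι] {X : ℕ → Ω → (ι → ℝ)}
    {P : ℕ → Kernel (ι → ℝ) (ι → ℝ)} [∀ n, IsMarkovKernel (P n)] (hX : ∀ n, Measurable (X n))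
    (hP : IsMarkovProcess μ X P) (hmono : IsMonotonic μ X P)
    (hb : ∀ n, ∀ᵐ ω ∂μ, condLaw μ (tail (generated X)) (X n) ω = μ.map (X n)) :
    IsStandard μ (generated X) := by
  have hM : ∀ n, HasCondLaw μ (generated X (n + 1)) (X n) (fun ω => P n (X (n + 1) ω)) :=
    fun n => (hasCondLaw_condLaw (generated_le hX (n + 1)) (hX n)).congr (hP n)
  obtain ⟨X', hX', hlaw, hM'⟩ := exists_adapted_copy hX hM hmono hb
  refine ⟨ℕ → ℕ → I, inferInstance, noise, inferInstance, generated X', noiseFiltration, ?_,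
    isProductType_noiseFiltration,
    isImmersed_of_hasCondLaw (generated_antitone _) noiseFiltration_le hX' hM'⟩
  refine ⟨fun _ => ι → ℝ, fun _ => inferInstance, fun _ => inferInstance, X, X', hX,
    fun n => (hX' n).mono (noiseFiltration_le n) le_rfl, fun _ => rfl, fun _ => rfl, ?_⟩
  exact map_eq_of_hasCondLaw (generated_antitone X) (generated_antitone _) (generated_le hX)
    noiseFiltration_le (fun n => measurable_generated X le_rfl) hX' (fun n => (hlaw n).symm) hM hM'

end NegTime

theorem theorem4p5 {Ω : Type*} [MeasurableSpace Ω] (μ : Measure Ω) [IsProbabilityMeasure μ]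
    {ι : Type} [Countable ι]
    (X : ℕ → Ω → (ι → ℝ)) (hX : ∀ n, Measurable (X n))
    (P : ℕ → Kernel (ι → ℝ) (ι → ℝ)) (hPmarkov : ∀ n, IsMarkovKernel (P n))
    (hP : NegTime.IsMarkovProcess μ X P) (hmono : NegTime.IsMonotonic μ X P) :
    List.TFAE [
      NegTime.IsKolmogorovian μ (NegTime.generated X),
      ∀ n : ℕ, ∀ᵐ ω ∂μ,
        NegTime.condLaw μ (NegTime.tail (NegTime.generated X)) (X n) ω = μ.map (X n),
      NegTime.IsStandard μ (NegTime.generated X)] := by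
  tfae_have 1 → 2 := fun h n =>
    NegTime.condLaw_ae_eq_of_indep (NegTime.tail_generated_le hX) (hX n)
      (h.indep (NegTime.tail_generated_le hX))
  tfae_have 2 → 3 := NegTime.isStandard_generated hX hP hmono
  tfae_have 3 → 1 := NegTime.IsStandard.isKolmogorovian
  tfae_finish
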